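/- Let $\log^* n$ denote the number of times $\log_2$ has to be applied, starting from $n$, until the value is at most $1$. The deterministic LOCAL model on a simple undirected $n$-node graph $G=(V,E)$ of maximum degree $\Delta$ is the following: the nodes have unique identifiers of $O(\log n)$ bits and compute in synchronous rounds; in each round every node sends a message of arbitrary size to each of its neighbors, receives the messages of its neighbors, and performs an arbitrary deterministic internal computation. Initially every node knows $n$, $\Delta$, its own identifier, the identifiers of its neighbors, and its part of the input; at the end every node outputs the colors of its incident edges. (1) List edge coloring. Assume that a color space $\mathcal C$ of size at most polynomial in $\Delta$, known to all nodes, is given, and that each edge $e=\{u,v\}\in E$ has a list $L_e\subseteq\mathcal C$, known to $u$ and $v$, of size $|L_e|\ge \deg(u)+\deg(v)-1$. Then there is a deterministic LOCAL algorithm that computes a color $x_e\in L_e$ for every edge $e$ such that any two distinct edges that share an endpoint have different colors, in $2^{O(\sqrt{\log_2\Delta})}+O(\log^* n)$ rounds. (2) Consequently, there is a deterministic LOCAL algorithm that computes a proper edge coloring of $G$ with $2\Delta-1$ colors (for $\Delta\ge1$) in $2^{O(\sqrt{\log_2\Delta})}+O(\log^* n)$ rounds. The constants hidden in the $O(\cdot)$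 terms depend only on the polynomial bound on $|\mathcal C|$ (in (1)) and on the constant in the length $O(\log n)$ of the identifiers. -/

import Mathlib

/-- The iterated logarithm `log* n`: the number of times the base-2 logarithm has to be applied,
starting from `n`, until the value is at most `1`. -/
noncomputable def logStar (n : ℕ) : ℕ :=
  sInf {k : ℕ | (Real.logb 2)^[k] (n : ℝ) ≤ 1}

/-- Data about the neighbors of `v`, keyed by their identifiers: `some (f u)` at the identifier of
a neighbor `u` of `v`, and `none` at every number that is not the identifier of a neighbor. -/
noncomputable def atNeighbors {V : Type*} {α : Type} (G : SimpleGraph V) (ID : V → ℕ) (v : V)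
    (f : V → α) : ℕ → Option α := fun i =>
  open Classical in
  if h : ∃ u, G.Adj v u ∧ ID u = i then some (f h.choose) else none

/-- A deterministic algorithm in the `LOCAL` model (synchronous rounds, messages of unbounded size,
arbitrary internal computation), for problems whose input consists of global data of type `γ` known
to every node and of data of type `ε` on each edge, known to the endpoints of the edge. Every node
produces an output of type `Out`. -/
structure LocalAlgorithm (γ ε Out : Type) where
  /-- the internal states of a node -/
  State : Type
  /-- the messages -/
  Msg : Type
  /-- `init n Δ g i inc` is the initial state of a node with identifier `i`, where `n` is the number
  of nodes, `Δ` the maximum degree, `g` the global data, and `inc` maps the identifier of each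
  neighbor to the data on the edge to that neighbor (and all other numbers to `none`). -/
  init : (n Δ : ℕ) → (g : γ) → (i : ℕ) → (inc : ℕ → Option ε) → State
  /-- `send s j` is the message that a node in state `s` sends to its neighbor with identifier `j` -/
  send : State → ℕ → Msg
  /-- `recv s inbox` is the next state of a node in state `s` that in this round receives the
  message `inbox j` from its neighbor with identifier `j` -/
  recv : State → (ℕ → Option Msg) → State
  /-- the output of a node in the given state; `none` if it has no output yet -/
  output : State → Option Out

namespace LocalAlgorithm

variable {γ ε Out : Type} {V : Type*} [Fintype V]

/-- The state of each node after `t` communication rounds on the network `G` with identifiers `ID`,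
global data `g`, and data `inp e` on each edge `e`. -/
noncomputable def run (A : LocalAlgorithm γ ε Out) (G : SimpleGraph V) [DecidableRel G.Adj]
    (ID : V → ℕ) (g : γ) (inp : Sym2 V → ε) : ℕ → V → A.State
  | 0 => fun v =>
      A.init (Fintype.card V) G.maxDegree g (ID v) (atNeighbors G ID v fun u => inp s(v, u))
  | t + 1 => fun v =>
      A.recv (A.run G ID g inp t v)
        (atNeighbors G ID v fun u => A.send (A.run G ID g inp t u) (ID v))

/-- Within the first `t` rounds node `v` produces an output, and its first output is `o`. -/
def OutputsWithin (A : LocalAlgorithm γ ε Out) (G : SimpleGraph V) [DecidableRel G.Adj]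
    (ID : V → ℕ) (g : γ) (inp : Sym2 V → ε) (t : ℕ) (v : V) (o : Out) : Prop :=
  ∃ s ≤ t, A.output (A.run G ID g inp s v) = some o ∧
    ∀ r < s, A.output (A.run G ID g inp r v) = none

/-- Within `t` rounds the algorithm computes the proper edge coloring `x` of `G`: every node outputs
the colors of its incident edges, keyed by the identifiers of its neighbors. -/
def ComputesEdgeColoring (A : LocalAlgorithm γ ε (ℕ → ℕ)) (G : SimpleGraph V)
    [DecidableRel G.Adj] (ID : V → ℕ) (g : γ) (inp : Sym2 V → ε) (t : ℕ)
    (x : G.lineGraph.Coloring ℕ) : Prop :=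
  ∀ v, ∃ o : ℕ → ℕ, A.OutputsWithin G ID g inp t v o ∧
    ∀ (u : V) (h : G.Adj v u), o (ID u) = x ⟨s(v, u), h⟩

end LocalAlgorithm

/-! With unbounded messages, a `t`-round algorithm is a function of what a node sees within `t`
rounds. All edges of all networks with the same `n`, `Δ` and color space are therefore put into one
graph (`ListNetwork.localStructure`), and running in `t` rounds becomes invariance under
indistinguishability (`IsLocal`). Choices may then be made by arbitrary existence arguments, and any
invariant function is turned back into an algorithm by `ListNetwork.decision_eq` and
`LocalAlgorithm.ofDecision`.

The combinatorics uses one property of line graphs: every neighborhood is covered by two cliques. In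
`exists_reduction` each vertex restricts its list to one of `p` subblocks of its color block.
Vertices act by increasing order of magnitude of their lists, and within one order by a defective
coloring. An averaging argument (`exists_heavy_part`) keeps the number of competitors decided no
later small relative to the new list. Competitors decided later are controlled by the cliques: in a
tournament with small out-degrees there are few vertices (`card_rivals_le`). One reduction divides
the ratio of list size to competing degree by only a constant, so `r` levels solve list coloring
when that ratio is exponential in `r` (`exists_coloring_of_slack`).

Lists merely larger than the degrees suffice after sparsification: a defective coloring splits the
uncolored vertices into classes of small internal degree, and in each class the vertices of still
high uncolored degree have the required slack. One pass halves the uncolored degree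
(`exists_phase`), so about `log Δ` passes finish. Taking `p = 2 ^ s` and `r` proportional to `s`,
for `s` about `√(log Δ)`, balances depth against branching, and all factors become `2 ^ O(s)`. Only
the initial coloring (Linial, `exists_poly_coloring`) costs `log* n` rounds. The second claim is the
case of equal lists with `2Δ - 1` colors. -/

/-! ### Locality as invariance under indistinguishability. -/

/-- A locally finite graph, given by its neighborhoods, in which every neighborhood is covered by
two cliques, together with relations `rel t` of indistinguishability after `t` communication
rounds. -/
structure LocalStructure (Ω : Type*) where
  /-- the neighborhoods -/
  nbr : Ω → Finset Ω
  /-- unique labels -/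
  uid : Ω → ℕ
  /-- indistinguishability after `t` rounds -/
  rel : ℕ → Ω → Ω → Prop
  nbr_symm : ∀ {x u}, u ∈ nbr x → x ∈ nbr u
  uid_inj : ∀ {x u w}, u ∈ nbr x → w ∈ nbr x → uid u = uid w → u = w
  uid_ne : ∀ {x u}, u ∈ nbr x → uid u ≠ uid x
  rel_symm : ∀ {t x y}, rel t x y → rel t y x
  rel_uid : ∀ {t x y}, rel t x y → uid x = uid y
  rel_of_succ : ∀ {t x y}, rel (t + 1) x y → rel t x y
  rel_nbr : ∀ {t x y}, rel (t + 1) x y → ∀ u ∈ nbr x, ∃ w ∈ nbr y, rel t u w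
  two_cliques : ∀ x, ∃ P : Ω → Prop, ∀ u ∈ nbr x, ∀ w ∈ nbr x, (P u ↔ P w) → u ≠ w → w ∈ nbr u

namespace LocalStructure

open scoped Classical

variable {Ω : Type*} (𝓛 : LocalStructure Ω) {α β : Type*} {s t : ℕ}

/-- The function `f` can be computed in `t` rounds. -/
def IsLocal (t : ℕ) (f : Ω → α) : Prop := ∀ ⦃x y⦄, 𝓛.rel t x y → f x = f y

variable {𝓛}

theorem rel_mono (h : s ≤ t) {x y : Ω} (hr : 𝓛.rel t x y) : 𝓛.rel s x y := by
  induction h with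
  | refl => exact hr
  | step _ ih => exact ih (𝓛.rel_of_succ hr)

theorem not_mem_nbr_self (x : Ω) : x ∉ 𝓛.nbr x := fun h => 𝓛.uid_ne h rfl

namespace IsLocal

theorem mono {f : Ω → α} (hf : 𝓛.IsLocal s f) (h : s ≤ t) : 𝓛.IsLocal t f :=
  fun _ _ hr => hf (rel_mono h hr)

theorem const (a : α) : 𝓛.IsLocal t fun _ => a := fun _ _ _ => rfl

theorem comp {f : Ω → α} (hf : 𝓛.IsLocal t f) (g : α → β) : 𝓛.IsLocal t fun x => g (f x) :=
  fun _ _ hr => congrArg g (hf hr)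

theorem prodMk {f : Ω → α} {g : Ω → β} (hf : 𝓛.IsLocal t f) (hg : 𝓛.IsLocal t g) :
    𝓛.IsLocal t fun x => (f x, g x) :=
  fun _ _ hr => Prod.ext (hf hr) (hg hr)

/-- Matching neighbors by indistinguishability preserves labels, which are distinct within a
neighborhood, so the matching is injective. -/
theorem card_nbr_le {f : Ω → α} (hf : 𝓛.IsLocal t f) (P : α → Prop) [DecidablePred P]
    {x y : Ω}    (hr : 𝓛.rel (t + 1) x y) :
    ((𝓛.nbr x).filter fun u => P (f u)).card ≤ ((𝓛.nbr y).filter fun u => P (f u)).card := by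
  choose! m hm hrel using 𝓛.rel_nbr hr
  refine Finset.card_le_card_of_injOn m ?_ ?_
  · intro u hu
    simp only [Finset.coe_filter, Set.mem_ofPred_eq] at hu ⊢
    exact ⟨hm u hu.1, hf (hrel u hu.1) ▸ hu.2⟩
  · intro u hu w hw he
    simp only [Finset.coe_filter, Set.mem_ofPred_eq] at hu hw
    refine 𝓛.uid_inj hu.1 hw.1 ?_
    rw [𝓛.rel_uid (hrel u hu.1), 𝓛.rel_uid (hrel w hw.1), he]

theorem card_nbr {f : Ω → α} (hf : 𝓛.IsLocal t f) (P : α → α → Prop)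
    [∀ a b, Decidable (P a b)] : 𝓛.IsLocal (t + 1) fun x => ((𝓛.nbr x).filter fun u => P (f x) (f u)).card := by
  intro x y hr
  have hxy := hf (𝓛.rel_of_succ hr)
  simp only [hxy]
  exact le_antisymm (card_nbr_le hf _ hr) (card_nbr_le hf _ (𝓛.rel_symm hr))

theorem exists_nbr {f : Ω → α} (hf : 𝓛.IsLocal t f) (P : α → α → Prop) :
    𝓛.IsLocal (t + 1) fun x => ∃ u ∈ 𝓛.nbr x, P (f x) (f u) := by
  intro x y hr
  simpa [Finset.card_pos, Finset.Nonempty] using (card_nbr hf P).comp (0 < ·) hr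

/-- A local constraint that can be satisfied everywhere can be satisfied by a local function. -/
theorem exists_choice [Nonempty β] {Good : Ω → β → Prop} (hG : 𝓛.IsLocal t Good)
    (hex : ∀ x, ∃ b, Good x b) : ∃ f : Ω → β, 𝓛.IsLocal t f ∧ ∀ x, Good x (f x) :=
  -- `Classical.epsilon` depends only on the predicate, so indistinguishable vertices make the same
  -- choice.
  ⟨fun x => Classical.epsilon (Good x), fun _ _ hr => by simp only [hG hr],
    fun x => Classical.epsilon_spec (hex x)⟩

end IsLocal

/-- Vertices decide one after the other along a schedule `σ`, each one based on the decisions of its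
neighbors that come earlier in the schedule. -/
theorem exists_scheduled [Nonempty β] {σ : Ω → ℕ} {T : ℕ} (hσ : 𝓛.IsLocal t σ)
    (hT : ∀ x, σ x < T) (Good : Ω → (Ω → β) → β → Prop)
    (hloc : ∀ s, t ≤ s → ∀ P : Ω → β, 𝓛.IsLocal s P → 𝓛.IsLocal (s + 1) fun x => Good x P)
    (hdep : ∀ x (P P' : Ω → β), (∀ u ∈ 𝓛.nbr x, σ u < σ x → P u = P' u) → Good x P = Good x P')
    (hex : ∀ x P, ∃ b, Good x P b) :
    ∃ P : Ω → β, 𝓛.IsLocal (t + T) P ∧ ∀ x, Good x P (P x) := by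
  obtain ⟨b₀⟩ := ‹Nonempty β›
  have key : ∀ k, ∃ P : Ω → β, 𝓛.IsLocal (t + k) P ∧ ∀ x, σ x < k → Good x P (P x) := by
    intro k
    induction k with
    | zero => exact ⟨fun _ => b₀, IsLocal.const _, fun x h => absurd h (Nat.not_lt_zero _)⟩
    | succ k ih =>
      obtain ⟨P, hP, hgood⟩ := ih
      have hl := hloc (t + k) (Nat.le_add_right _ _) P hP
      obtain ⟨f, hf, hfg⟩ := hl.exists_choice (fun x => hex x P)
      refine ⟨fun x => if σ x = k then f x else P x, ?_, ?_⟩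
      · intro x y hr
        have h1 := hσ (rel_mono (by omega) hr)
        have h2 := hf (x := x) (y := y) (rel_mono (by omega) hr)
        have h3 := hP (rel_mono (by omega) hr)
        simp only [h1, h2, h3]
      · intro x hx
        -- Slot `k` does not disturb decisions already made: for `σ x ≤ k` only neighbors in slots
        -- before `k` matter.
        have e : Good x (fun x => if σ x = k then f x else P x) = Good x P := by
          apply hdep
          intro u _ hu
          have : σ u ≠ k := by omega
          simp [this]
        rw [e]
        by_cases h : σ x = k
        · simpa [h] using hfg x
        · simpa [h] using hgood x (by omega)
  obtain ⟨P, hP, h⟩ := key T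
  exact ⟨P, hP, fun x => h x (hT x)⟩

/-! ### Defective coloring by polynomials over finite fields. -/

/-- There are `q ^ D` functions on a finite field of size `q` any two of which agree at fewer than
`D` points. -/
theorem exists_code {m w D : ℕ} (hw : w ≠ 0) (hm : m ≤ (2 ^ w) ^ D) :
    ∃ F : ℕ → Fin (2 ^ w) → Fin (2 ^ w), ∀ c < m, ∀ c' < m, c ≠ c' →
      (Finset.univ.filter fun a => F c a = F c' a).card ≤ D := by
  have : Fact (Nat.Prime 2) := ⟨Nat.prime_two⟩
  let K := GaloisField 2 w
  have : Fintype K := Fintype.ofFinite K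
  have hK : Fintype.card K = 2 ^ w := by
    rw [← Nat.card_eq_fintype_card]; exact GaloisField.card 2 w hw
  have e : K ≃ Fin (2 ^ w) := Fintype.equivFinOfCardEq hK
  obtain ⟨g⟩ : Nonempty (Fin m ↪ (Fin D → K)) := by
    apply Function.Embedding.nonempty_of_card_le
    simpa [hK] using hm
  -- A color becomes the coefficient vector of a polynomial; agreement points of two colors are
  -- roots of a nonzero difference.
  let p : Fin m → Polynomial K := fun c =>
    ∑ i : Fin D, Polynomial.monomial (i : ℕ) (g c i)
  have hpc : ∀ c (i : Fin D), (p c).coeff i = g c i := by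
    intro c i
    simp only [p, Polynomial.finsetSum_coeff, Polynomial.coeff_monomial]
    rw [Finset.sum_eq_single i]
    · simp
    · intro j _ hj
      rw [if_neg]
      exact fun h => hj (Fin.ext h)
    · simp
  have hinj : Function.Injective p := by
    intro c c' h
    apply g.injective
    funext i
    rw [← hpc, ← hpc, h]
  have hdeg : ∀ c, (p c).natDegree ≤ D := by
    intro c
    refine Polynomial.natDegree_sum_le_of_forall_le _ _ fun i _ => ?_
    exact (Polynomial.natDegree_monomial_le _).trans i.2.le
  refine ⟨fun c a => if h : c < m then e ((p ⟨c, h⟩).eval (e.symm a)) else a, ?_⟩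
  intro c hc c' hc' hne
  simp only [hc, hc', dite_true, EmbeddingLike.apply_eq_iff_eq]
  have hp : p ⟨c, hc⟩ - p ⟨c', hc'⟩ ≠ 0 := by
    rw [sub_ne_zero]
    intro h
    exact hne (by simpa using hinj h)
  calc _ = ((Finset.univ.filter fun a => (p ⟨c, hc⟩).eval (e.symm a) =
          (p ⟨c', hc'⟩).eval (e.symm a)).image e.symm).card :=
        (Finset.card_image_of_injective _ e.symm.injective).symm
    _ ≤ (p ⟨c, hc⟩ - p ⟨c', hc'⟩).roots.toFinset.card := by
        apply Finset.card_le_card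
        intro a ha
        simp only [Finset.mem_image, Finset.mem_filter, Finset.mem_univ, true_and] at ha
        obtain ⟨b, hb, rfl⟩ := ha
        rw [Multiset.mem_toFinset, Polynomial.mem_roots hp]
        simp [Polynomial.IsRoot, hb]
    _ ≤ (p ⟨c, hc⟩ - p ⟨c', hc'⟩).natDegree :=
        (Multiset.toFinset_card_le _).trans (Polynomial.card_roots' _)
    _ ≤ D := (Polynomial.natDegree_sub_le _ _).trans (max_le (hdeg _) (hdeg _))

/-- Defective coloring: given a proper coloring with `m` colors, one round suffices for a coloring
with few colors in which only a small fraction of the selected neighbors has the same color. -/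
theorem exists_defective {φ : Ω → ℕ} {m w D X : ℕ} (hφ : 𝓛.IsLocal t φ) (hφm : ∀ x, φ x < m)
    (hproper : ∀ x, ∀ u ∈ 𝓛.nbr x, φ u ≠ φ x) (hw : w ≠ 0)
    (hm : m ≤ (2 ^ w) ^ D) (hX : X * D ≤ 2 ^ w) {f : Ω → α} (hf : 𝓛.IsLocal t f)
    (P : α → α → Prop) [∀ a b, Decidable (P a b)] :
    ∃ ψ : Ω → ℕ, 𝓛.IsLocal (t + 1) ψ ∧ (∀ x, ψ x < 2 ^ w * 2 ^ w) ∧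
      ∀ x, X * ((𝓛.nbr x).filter fun u => P (f x) (f u) ∧ ψ u = ψ x).card ≤
        ((𝓛.nbr x).filter fun u => P (f x) (f u)).card := by
  obtain ⟨F, hF⟩ := exists_code hw hm
  let cnt : Ω → Fin (2 ^ w) → ℕ := fun x a =>
    ((𝓛.nbr x).filter fun u => P (f x) (f u) ∧ F (φ u) a = F (φ x) a).card
  let deg : Ω → ℕ := fun x => ((𝓛.nbr x).filter fun u => P (f x) (f u)).card
  have hcnt : 𝓛.IsLocal (t + 1) cnt := by
    intro x y hr
    funext a
    exact (hf.prodMk hφ).card_nbr (fun v v' => P v.1 v'.1 ∧ F v'.2 a = F v.2 a) hr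
  have hdeg : 𝓛.IsLocal (t + 1) deg := hf.card_nbr P
  have hG : 𝓛.IsLocal (t + 1) fun x a => X * cnt x a ≤ deg x := by
    intro x y hr
    simp only [hcnt hr, hdeg hr]
  -- Averaging over evaluation points: each selected neighbor collides at no more than `D` of the `2
  -- ^ w ≥ X * D` points.
  obtain ⟨a, ha, hgood⟩ := hG.exists_choice (β := Fin (2 ^ w)) (by
    intro x
    by_contra! hcon
    have h1 : ∑ a, cnt x a ≤ deg x * D := by
      have : ∑ a, cnt x a = ∑ u ∈ (𝓛.nbr x).filter (fun u => P (f x) (f u)),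
          (Finset.univ.filter fun a => F (φ u) a = F (φ x) a).card := by
        simp only [cnt, Finset.card_filter, Finset.sum_filter]
        rw [Finset.sum_comm]
        refine Finset.sum_congr rfl fun u _ => ?_
        by_cases hP : P (f x) (f u) <;> simp [hP]
      rw [this]
      refine (Finset.sum_le_card_nsmul _ _ D ?_).trans (by simp [deg])
      intro u hu
      exact hF _ (hφm u) _ (hφm x) (hproper x u (Finset.mem_filter.1 hu).1)
    have h2 : ∑ _a : Fin (2 ^ w), deg x < ∑ a, X * cnt x a :=
      Finset.sum_lt_sum_of_nonempty Finset.univ_nonempty fun a _ => hcon a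
    rw [Finset.sum_const, Finset.card_univ, Fintype.card_fin, smul_eq_mul,
      ← Finset.mul_sum] at h2
    have h3 : X * ∑ a, cnt x a ≤ X * (deg x * D) := Nat.mul_le_mul_left _ h1
    have h4 : X * (deg x * D) ≤ 2 ^ w * deg x := by
      calc X * (deg x * D) = X * D * deg x := by ring
        _ ≤ _ := Nat.mul_le_mul_right _ hX
    omega)
  -- The point is part of the new color, so a neighbor of equal color used the same point and is a
  -- counted collision.
  refine ⟨fun x => (finProdFinEquiv (a x, F (φ x) (a x)) : Fin (2 ^ w * 2 ^ w)), ?_,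
    fun x => Fin.is_lt _, ?_⟩
  · intro x y hr
    simp only [ha hr, hφ (𝓛.rel_of_succ hr)]
  · intro x
    refine le_trans (Nat.mul_le_mul_left _ (Finset.card_le_card ?_)) (hgood x)
    intro u hu
    simp only [Finset.mem_filter] at hu ⊢
    obtain ⟨hu, hP, he⟩ := hu
    have he := finProdFinEquiv.injective (Fin.ext he)
    simp only [Prod.mk.injEq] at he
    exact ⟨hu, hP, by rw [← he.1]; rw [he.2, he.1]⟩

end LocalStructure

/-! ### One step of color space reduction. -/

/-- Among the at most `p` parts of a set one contains a fraction `1 / (2 * p)` of the set while its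
share of a total weight `n` is at most twice the share of the set. -/
theorem exists_heavy_part {ι : Type*} [DecidableEq ι] {A : Finset ℕ} (g : ℕ → ι) (a : ι → ℕ)
    {n p : ℕ} (hA : A.Nonempty) (hp : (A.image g).card ≤ p) (ha : ∑ i ∈ A.image g, a i ≤ n) :
    ∃ i ∈ A.image g, A.card ≤ 2 * p * (A.filter fun c => g c = i).card ∧
      a i * A.card ≤ 2 * n * (A.filter fun c => g c = i).card := by
  by_contra! hcon
  set l : ι → ℕ := fun i => (A.filter fun c => g c = i).card with hl
  set I := A.image g
  have hsum : ∑ i ∈ I, l i = A.card := (Finset.card_eq_sum_card_image g A).symm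
  have hApos : 0 < A.card := hA.card_pos
  set good := I.filter fun i => A.card ≤ 2 * p * l i
  set bad := I.filter fun i => ¬ A.card ≤ 2 * p * l i
  have hsplit : ∑ i ∈ good, l i + ∑ i ∈ bad, l i = A.card := by
    rw [← hsum]; exact Finset.sum_filter_add_sum_filter_not _ _ _
  have hIpos : 0 < p := lt_of_lt_of_le (Finset.card_pos.2 (hA.image g)) hp
  -- At most `p` parts are lighter than `1 / (2 * p)` of the set, so the others hold at least half
  -- of it; averaging the weight over those loses the factor 2.
  have hbad : 2 * ∑ i ∈ bad, l i ≤ A.card := by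
    have h1 : ∑ i ∈ bad, 2 * p * l i ≤ bad.card * A.card := by
      refine (Finset.sum_le_card_nsmul _ _ A.card ?_).trans (by simp)
      intro i hi
      exact (not_le.1 (Finset.mem_filter.1 hi).2).le
    have h2 : bad.card * A.card ≤ p * A.card :=
      Nat.mul_le_mul_right _ ((Finset.card_filter_le _ _).trans hp)
    rw [← Finset.mul_sum] at h1
    have h3 : p * (2 * ∑ i ∈ bad, l i) ≤ p * A.card := by
      calc _ = 2 * p * ∑ i ∈ bad, l i := by ring
        _ ≤ _ := h1.trans h2
    exact Nat.le_of_mul_le_mul_left h3 hIpos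
  have hgood : A.card ≤ 2 * ∑ i ∈ good, l i := by omega
  have hgne : good.Nonempty := by
    by_contra h
    rw [Finset.not_nonempty_iff_eq_empty.1 h, Finset.sum_empty] at hgood
    omega
  have h1 : ∑ i ∈ good, 2 * n * l i < ∑ i ∈ good, a i * A.card :=
    Finset.sum_lt_sum_of_nonempty hgne fun i hi =>
      hcon i (Finset.mem_filter.1 hi).1 (Finset.mem_filter.1 hi).2
  rw [← Finset.mul_sum, ← Finset.sum_mul] at h1
  have h2 : ∑ i ∈ good, a i ≤ n :=
    (Finset.sum_le_sum_of_subset (Finset.filter_subset _ _)).trans ha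
  have h3 : (∑ i ∈ good, a i) * A.card ≤ n * (2 * ∑ i ∈ good, l i) := Nat.mul_le_mul h2 hgood
  have h4 : n * (2 * ∑ i ∈ good, l i) = 2 * n * ∑ i ∈ good, l i := by ring
  omega

/-- A tournament in which all out-degrees are small has few vertices. -/
theorem card_le_of_tournament {Ω : Type*} [DecidableEq Ω] {Q : Finset Ω} {v : Ω} (hv : v ∉ Q)
    (out : Ω → Finset Ω) {S b : ℕ} (hout : ∀ w ∈ insert v Q, S * (out w).card ≤ b)
    (htot : ∀ w ∈ insert v Q, ∀ u ∈ insert v Q, u ≠ w → u ∈ out w ∨ w ∈ out u) :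
    S * Q.card ≤ 2 * b := by
  set W := insert v Q
  have hW : W.card = Q.card + 1 := Finset.card_insert_of_notMem hv
  set E : Finset (Ω × Ω) := (W.sigma out).image fun e => (e.1, e.2)
  have hE : E.card ≤ ∑ w ∈ W, (out w).card :=
    Finset.card_image_le.trans (Finset.card_sigma _ _).le
  have hsub : W.offDiag ⊆ E ∪ E.image Prod.swap := by
    rintro ⟨w, u⟩ h
    rw [Finset.mem_offDiag] at h
    obtain ⟨hw, hu, hne⟩ := h
    simp only [E, Finset.mem_union, Finset.mem_image, Finset.mem_sigma, Sigma.exists, Prod.mk.injEq,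
      Prod.exists, Prod.swap_prod_mk]
    rcases htot w hw u hu (Ne.symm hne) with h | h
    · exact Or.inl ⟨w, u, ⟨hw, h⟩, rfl, rfl⟩
    · exact Or.inr ⟨u, w, ⟨u, w, ⟨hu, h⟩, rfl, rfl⟩, rfl, rfl⟩
  have h1 : W.card * W.card - W.card ≤ 2 * ∑ w ∈ W, (out w).card := by
    rw [← Finset.offDiag_card]
    have h2 := (Finset.card_le_card hsub).trans (Finset.card_union_le _ _)
    have h3 : (E.image Prod.swap).card ≤ E.card := Finset.card_image_le
    omega
  have h2 : S * ∑ w ∈ W, (out w).card ≤ W.card * b := by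
    rw [Finset.mul_sum]
    exact (Finset.sum_le_card_nsmul _ _ b hout).trans (by simp)
  have h3 : W.card * W.card - W.card = (Q.card + 1) * Q.card := by
    rw [hW]
    exact Nat.sub_eq_of_eq_add (by ring)
  rw [h3] at h1
  rw [hW] at h2
  refine Nat.le_of_mul_le_mul_left (c := Q.card + 1) ?_ (by omega)
  calc (Q.card + 1) * (S * Q.card) = S * ((Q.card + 1) * Q.card) := by ring
    _ ≤ S * (2 * ∑ w ∈ insert v Q, (out w).card) := Nat.mul_le_mul_left _ h1
    _ = 2 * (S * ∑ w ∈ insert v Q, (out w).card) := by ring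
    _ ≤ 2 * ((Q.card + 1) * b) := Nat.mul_le_mul_left _ h2
    _ = _ := by ring

namespace LocalStructure

open scoped Classical

variable {Ω : Type*} {𝓛 : LocalStructure Ω} {t : ℕ}

variable (𝓛) in
/-- The neighbors of `x` with a nonempty list and the same key, whose lists are not of a larger
order of magnitude than the list of `x`. -/
noncomputable def rivals (A : Ω → Finset ℕ) (κ : Ω → ℕ) (x : Ω) : Finset Ω :=
  (𝓛.nbr x).filter fun u =>
    (A u).Nonempty ∧ κ u = κ x ∧ Nat.log 2 (A u).card ≤ Nat.log 2 (A x).card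

/-- The list `A x` restricted to the block of length `B` with number `κ x`. -/
def restrictBlock (A : Ω → Finset ℕ) (B : ℕ) (κ : Ω → ℕ) (x : Ω) : Finset ℕ :=
  (A x).filter fun c => c / B = κ x

/-- One color space reduction: when the vertices pick subblocks such that the number of rivals that
are not later in a schedule is small for all vertices, the number of rivals in the subblocks is
small. -/
theorem card_rivals_le {A A' : Ω → Finset ℕ} {κ κ' σ : Ω → ℕ} {S : ℕ}
    (hA : ∀ x, (A' x).Nonempty → (A x).Nonempty)
    (hκ : ∀ x y, (A' x).Nonempty → (A' y).Nonempty → κ' x = κ' y → κ x = κ y)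
    (hσ : ∀ x y, (A' x).Nonempty → (A' y).Nonempty → σ x ≤ σ y →
      Nat.log 2 (A x).card ≤ Nat.log 2 (A y).card)
    (hout : ∀ x, (A' x).Nonempty →
      S * ((𝓛.rivals A κ x).filter fun u => κ' u = κ' x ∧ σ u ≤ σ x).card ≤ 3 * (A' x).card)
    (x : Ω) (hx : (A' x).Nonempty) : S * (𝓛.rivals A' κ' x).card ≤ 24 * (A' x).card := by
  obtain ⟨P, hP⟩ := 𝓛.two_cliques x
  set out : Ω → Finset Ω := fun w => (𝓛.rivals A κ w).filter fun u => κ' u = κ' w ∧ σ u ≤ σ w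
  -- A clique of rivals together with `x` is a tournament oriented towards the vertex that is not
  -- later. Each list in it has less than twice the size of `A' x`, which turns 3 into 6; two
  -- cliques then give `2 * (2 * 6) = 24`.
  have key : ∀ Q ⊆ 𝓛.rivals A' κ' x, (∀ u ∈ Q, ∀ w ∈ Q, u ≠ w → w ∈ 𝓛.nbr u) →
      S * Q.card ≤ 2 * (6 * (A' x).card) := by
    intro Q hQ hcl
    have hQ' : ∀ u ∈ Q, u ∈ 𝓛.nbr x ∧ (A' u).Nonempty ∧ κ' u = κ' x ∧
        Nat.log 2 (A' u).card ≤ Nat.log 2 (A' x).card := fun u hu => by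
      simpa [rivals] using hQ hu
    have hxQ : x ∉ Q := fun h => not_mem_nbr_self x (hQ' x h).1
    have hW : ∀ w ∈ insert x Q, (A' w).Nonempty ∧ κ' w = κ' x ∧
        Nat.log 2 (A' w).card ≤ Nat.log 2 (A' x).card := by
      intro w hw
      rcases Finset.mem_insert.1 hw with rfl | hw
      · exact ⟨hx, rfl, le_rfl⟩
      · exact (hQ' w hw).2
    have hadj : ∀ w ∈ insert x Q, ∀ u ∈ insert x Q, u ≠ w → u ∈ 𝓛.nbr w := by
      intro w hw u hu hne
      rcases Finset.mem_insert.1 hw with h | h <;> rcases Finset.mem_insert.1 hu with h' | h'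
      · exact absurd (h'.trans h.symm) hne
      · exact h ▸ (hQ' u h').1
      · exact h' ▸ 𝓛.nbr_symm (hQ' w h).1
      · exact hcl w h u h' hne.symm
    refine card_le_of_tournament hxQ out ?_ ?_
    · intro w hw
      refine (hout w (hW w hw).1).trans ?_
      have h1 : (A' w).card < 2 ^ (Nat.log 2 (A' w).card + 1) :=
        Nat.lt_pow_succ_log_self (by norm_num) _
      have h2 : 2 ^ Nat.log 2 (A' x).card ≤ (A' x).card :=
        Nat.pow_log_le_self _ hx.card_pos.ne'
      have h3 : 2 ^ (Nat.log 2 (A' w).card + 1) ≤ 2 ^ (Nat.log 2 (A' x).card + 1) :=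
        Nat.pow_le_pow_right (by norm_num) (by have := (hW w hw).2.2; omega)
      rw [pow_succ 2 (Nat.log 2 (A' x).card)] at h3
      omega
    · intro w hw u hu hne
      have main : ∀ w ∈ insert x Q, ∀ u ∈ insert x Q, u ≠ w → σ u ≤ σ w → u ∈ out w := by
        intro w hw u hu hne hle
        have hk : κ' u = κ' w := (hW u hu).2.1.trans (hW w hw).2.1.symm
        simp only [out, rivals, Finset.mem_filter]
        exact ⟨⟨hadj w hw u hu hne, hA u (hW u hu).1, hκ u w (hW u hu).1 (hW w hw).1 hk,
          hσ u w (hW u hu).1 (hW w hw).1 hle⟩, hk, hle⟩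
      rcases le_total (σ u) (σ w) with h | h
      · exact Or.inl (main w hw u hu hne h)
      · exact Or.inr (main u hu w hw hne.symm h)
  have hnbr : ∀ u ∈ 𝓛.rivals A' κ' x, u ∈ 𝓛.nbr x := fun u hu => (Finset.mem_filter.1 hu).1
  have h1 := key ((𝓛.rivals A' κ' x).filter P) (Finset.filter_subset _ _) (by
    intro u hu w hw hne
    rw [Finset.mem_filter] at hu hw
    exact hP u (hnbr u hu.1) w (hnbr w hw.1) (iff_of_true hu.2 hw.2) hne)
  have h2 := key ((𝓛.rivals A' κ' x).filter fun u => ¬ P u) (Finset.filter_subset _ _) (by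
    intro u hu w hw hne
    rw [Finset.mem_filter] at hu hw
    exact hP u (hnbr u hu.1) w (hnbr w hw.1) (iff_of_false hu.2 hw.2) hne)
  have h3 := Finset.card_filter_add_card_filter_not (s := 𝓛.rivals A' κ' x) P
  rw [← h3, mul_add]
  omega

/-- Slack `24 * S` drops to `S`. Rivals in earlier slots are visible when a vertex picks its
subblock, those in the same slot are few by the defect, and those in later slots are left to
`card_rivals_le`. -/
theorem exists_reduction {A : Ω → Finset ℕ} {κ φ : Ω → ℕ} {B p S M m w D : ℕ} (hp : 0 < p)
    (hA : 𝓛.IsLocal t A) (hκ : 𝓛.IsLocal t κ) (hφ : 𝓛.IsLocal t φ) (hM : ∀ x, Nat.log 2 (A x).card < M)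
    (hkey : ∀ x, ∀ c ∈ A x, c / (B * p) = κ x)
    (hslack : ∀ x, (A x).Nonempty → 24 * S * (𝓛.rivals A κ x).card ≤ (A x).card)
    (hφm : ∀ x, φ x < m) (hproper : ∀ x, ∀ u ∈ 𝓛.nbr x, φ u ≠ φ x) (hw : w ≠ 0)
    (hm : m ≤ (2 ^ w) ^ D) (hD : 2 * p * D ≤ 2 ^ w) :
    ∃ κ' : Ω → ℕ, 𝓛.IsLocal (t + 1 + M * (2 ^ w * 2 ^ w)) κ' ∧
      (∀ x, (A x).Nonempty → (restrictBlock A B κ' x).Nonempty) ∧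
      ∀ x, (restrictBlock A B κ' x).Nonempty →
        S * (𝓛.rivals (restrictBlock A B κ') κ' x).card ≤ (restrictBlock A B κ' x).card := by
  obtain ⟨ψ, hψ, hψlt, hdef⟩ := exists_defective hφ hφm hproper hw hm hD (hA.prodMk hκ)
    (fun v v' => v'.1.Nonempty ∧ v'.2 = v.2 ∧ Nat.log 2 v'.1.card ≤ Nat.log 2 v.1.card)
  set q := 2 ^ w * 2 ^ w
  have hA1 : 𝓛.IsLocal (t + 1) A := hA.mono (Nat.le_succ _)
  -- Lexicographic order: magnitude of the list, then defective color.
  let σ : Ω → ℕ := fun x => Nat.log 2 (A x).card * q + ψ x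
  have hσ : 𝓛.IsLocal (t + 1) σ := (hA1.prodMk hψ).comp fun v => Nat.log 2 v.1.card * q + v.2
  have hσlt : ∀ x, σ x < M * q := by
    intro x
    calc σ x < Nat.log 2 (A x).card * q + q := Nat.add_lt_add_left (hψlt x) _
      _ = (Nat.log 2 (A x).card + 1) * q := by ring
      _ ≤ M * q := Nat.mul_le_mul_right _ (hM x)
  have hriv : 𝓛.IsLocal (t + 1) fun x => (𝓛.rivals A κ x).card :=
    (hA.prodMk hκ).card_nbr
      (fun v v' => v'.1.Nonempty ∧ v'.2 = v.2 ∧ Nat.log 2 v'.1.card ≤ Nat.log 2 v.1.card)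
  let a : Ω → (Ω → ℕ) → ℕ → ℕ := fun x P i =>
    ((𝓛.nbr x).filter fun u => ((A u).Nonempty ∧ κ u = κ x ∧
      Nat.log 2 (A u).card ≤ Nat.log 2 (A x).card) ∧ σ u < σ x ∧ P u = i).card
  let Good : Ω → (Ω → ℕ) → ℕ → Prop := fun x P i => (A x).Nonempty →
    i ∈ (A x).image (· / B) ∧ (A x).card ≤ 2 * p * ((A x).filter fun c => c / B = i).card ∧
      a x P i * (A x).card ≤
        2 * (𝓛.rivals A κ x).card * ((A x).filter fun c => c / B = i).card
  obtain ⟨κ', hκ', hgood⟩ := exists_scheduled hσ hσlt Good (by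
    intro s hs P hP x y hr
    have e1 := hA1 (rel_mono (by omega) hr)
    have e2 := hriv (rel_mono (by omega) hr)
    have e3 : a x P = a y P := by
      funext i
      exact ((((hA1.mono hs).prodMk (hκ.mono (by omega))).prodMk (hσ.mono hs)).prodMk hP).card_nbr
        (fun v v' => (v'.1.1.1.Nonempty ∧ v'.1.1.2 = v.1.1.2 ∧
          Nat.log 2 v'.1.1.1.card ≤ Nat.log 2 v.1.1.1.card) ∧ v'.1.2 < v.1.2 ∧ v'.2 = i) hr
    simp only [Good, e1, e2, e3]) (by
    intro x P P' h
    have e : a x P = a x P' := by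
      funext i
      simp only [a]
      congr 1
      refine Finset.filter_congr fun u hu => ?_
      refine and_congr_right fun _ => and_congr_right fun hlt => ?_
      rw [h u hu hlt]
    simp only [Good, e]) (by
    intro x P
    by_cases hx : (A x).Nonempty
    · obtain ⟨i, hi⟩ := exists_heavy_part (· / B) (a x P) (n := (𝓛.rivals A κ x).card) (p := p) hx
        (by
          have : (A x).image (· / B) ⊆ Finset.Ico (κ x * p) (κ x * p + p) := by
            intro i hi
            obtain ⟨c, hc, rfl⟩ := Finset.mem_image.1 hi
            have := hkey x c hc
            rw [← Nat.div_div_eq_div_mul] at this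
            rw [Finset.mem_Ico, ← this]
            exact ⟨Nat.div_mul_le_self _ _, Nat.lt_div_mul_add hp⟩
          simpa using Finset.card_le_card this)
        (by
          have : ∀ i, a x P i = ((((𝓛.rivals A κ x).filter fun u => σ u < σ x)).filter
              fun u => P u = i).card := by
            intro i
            simp only [a, rivals, Finset.filter_filter, and_assoc]
          simp only [this]
          rw [Finset.sum_card_fiberwise_eq_card_filter]
          exact (Finset.card_filter_le _ _).trans (Finset.card_filter_le _ _))
      exact ⟨i, fun _ => hi⟩
    · exact ⟨0, fun h => absurd h hx⟩)
  have hne : ∀ x, (A x).Nonempty → (restrictBlock A B κ' x).Nonempty := by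
    intro x hx
    obtain ⟨c, hc, he⟩ := Finset.mem_image.1 (hgood x hx).1
    exact ⟨c, Finset.mem_filter.2 ⟨hc, he⟩⟩
  have hne' : ∀ x, (restrictBlock A B κ' x).Nonempty → (A x).Nonempty :=
    fun x hx => hx.mono (Finset.filter_subset _ _)
  refine ⟨κ', hκ', hne, fun x hx => ?_⟩
  refine Nat.le_of_mul_le_mul_left (c := 24) ?_ (Nat.succ_pos 23)
  rw [← mul_assoc]
  refine card_rivals_le (σ := σ) (κ := κ) hne' ?_ ?_ ?_ x hx
  · rintro x y ⟨c, hc⟩ ⟨d, hd⟩ he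
    rw [restrictBlock, Finset.mem_filter] at hc hd
    rw [← hkey x c hc.1, ← hkey y d hd.1, ← Nat.div_div_eq_div_mul, ← Nat.div_div_eq_div_mul,
      hc.2, hd.2, he]
  · intro x y _ _ hle
    by_contra! hlt
    have h1 : (Nat.log 2 (A y).card + 1) * q ≤ Nat.log 2 (A x).card * q :=
      Nat.mul_le_mul_right _ hlt
    have h2 := hψlt y
    simp only [σ] at hle
    rw [add_mul, one_mul] at h1
    omega
  · intro x hx
    have hAx := hne' x hx
    obtain ⟨-, hg1, hg2⟩ := hgood x hAx
    have hs := hslack x hAx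
    have hd : 2 * p * ((𝓛.rivals A κ x).filter fun u => ψ u = ψ x).card ≤
        (𝓛.rivals A κ x).card := by
      have := hdef x
      simpa only [rivals, Finset.filter_filter] using this
    have hsplit : ((𝓛.rivals A κ x).filter fun u => κ' u = κ' x ∧ σ u ≤ σ x).card ≤
        a x κ' (κ' x) + ((𝓛.rivals A κ x).filter fun u => ψ u = ψ x).card := by
      refine (Finset.card_le_card ?_).trans (Finset.card_union_le _ _)
      intro u hu
      simp only [rivals, Finset.mem_filter, Finset.mem_union] at hu ⊢
      obtain ⟨⟨hu1, hu2⟩, hk, hle⟩ := hu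
      rcases hle.lt_or_eq with h | h
      · exact Or.inl ⟨hu1, hu2, h, hk⟩
      · refine Or.inr ⟨⟨hu1, hu2⟩, ?_⟩
        have h1 := congrArg (· % q) h
        simp only [σ] at h1
        rwa [Nat.mul_add_mod_self_right, Nat.mul_add_mod_self_right, Nat.mod_eq_of_lt (hψlt u),
          Nat.mod_eq_of_lt (hψlt x)] at h1
    set n := (𝓛.rivals A κ x).card
    set l := (A x).card
    set l' := (restrictBlock A B κ' x).card
    set δ := ((𝓛.rivals A κ x).filter fun u => ψ u = ψ x).card
    have hl : 0 < l := hAx.card_pos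
    change l ≤ 2 * p * l' at hg1
    change a x κ' (κ' x) * l ≤ 2 * n * l' at hg2
    -- The constant 3 in `card_rivals_le` is 2 from the earlier rivals plus 1 from the rivals in the
    -- same slot.
    have h1 : 24 * S * a x κ' (κ' x) ≤ 2 * l' := by
      refine Nat.le_of_mul_le_mul_right ?_ hl
      calc 24 * S * a x κ' (κ' x) * l = 24 * S * (a x κ' (κ' x) * l) := by ring
        _ ≤ 24 * S * (2 * n * l') := Nat.mul_le_mul_left _ hg2
        _ = 2 * l' * (24 * S * n) := by ring
        _ ≤ 2 * l' * l := Nat.mul_le_mul_left _ hs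
    have h2 : 24 * S * δ ≤ l' := by
      refine Nat.le_of_mul_le_mul_left ?_ (show 0 < 2 * p by omega)
      calc 2 * p * (24 * S * δ) = 24 * S * (2 * p * δ) := by ring
        _ ≤ 24 * S * n := Nat.mul_le_mul_left _ hd
        _ ≤ l := hs
        _ ≤ _ := hg1
    calc _ ≤ 24 * S * (a x κ' (κ' x) + δ) := Nat.mul_le_mul_left _ hsplit
      _ = 24 * S * a x κ' (κ' x) + 24 * S * δ := by ring
      _ ≤ _ := by omega

end LocalStructure

/-! ### List coloring with slack, by recursion on the color space. -/

namespace LocalStructure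

open scoped Classical

variable {Ω : Type*} {𝓛 : LocalStructure Ω} {t : ℕ}

/-- Each level divides the block length by `p` and the slack by 24. At block length 1 the lists are
singletons, and the remaining slack 2 excludes any rival. Neighbors that part into different
subblocks can no longer conflict. -/
theorem exists_coloring_of_rivals {φ : Ω → ℕ} {p M m w D r : ℕ} (hp : 0 < p)
    (hφ : ∀ x, φ x < m) (hproper : ∀ x, ∀ u ∈ 𝓛.nbr x, φ u ≠ φ x) (hw : w ≠ 0)
    (hm : m ≤ (2 ^ w) ^ D) (hD : 2 * p * D ≤ 2 ^ w) {A : Ω → Finset ℕ} {κ : Ω → ℕ}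
    (hlφ : 𝓛.IsLocal t φ) (hA : 𝓛.IsLocal t A) (hκ : 𝓛.IsLocal t κ)
    (hM : ∀ x, Nat.log 2 (A x).card < M) (hkey : ∀ x, ∀ c ∈ A x, c / p ^ r = κ x)
    (hslack : ∀ x, (A x).Nonempty → 2 * 24 ^ r * (𝓛.rivals A κ x).card ≤ (A x).card) :
    ∃ y : Ω → ℕ, 𝓛.IsLocal (t + r * (1 + M * (2 ^ w * 2 ^ w))) y ∧
      (∀ x, (A x).Nonempty → y x ∈ A x) ∧
      ∀ x, (A x).Nonempty → ∀ u ∈ 𝓛.nbr x, (A u).Nonempty → κ u = κ x → y u ≠ y x := by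
  induction r generalizing t A κ with
  | zero =>
    have hmem : ∀ x, (A x).Nonempty → A x = {κ x} := by
      rintro x ⟨c, hc⟩
      ext d
      rw [Finset.mem_singleton]
      constructor
      · intro hd
        simpa using hkey x d hd
      · rintro rfl
        have := hkey x c hc
        rw [pow_zero, Nat.div_one] at this
        rwa [← this]
    refine ⟨κ, by simpa using hκ, fun x hx => by simp [hmem x hx], ?_⟩
    intro x hx u hu hAu he
    exfalso
    have h1 := hslack x hx
    rw [hmem x hx] at h1
    have h2 : u ∈ 𝓛.rivals A κ x := by
      simp only [rivals, Finset.mem_filter]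
      exact ⟨hu, hAu, he, by simp [hmem x hx, hmem u hAu]⟩
    have h3 := Finset.card_pos.2 ⟨u, h2⟩
    simp at h1
    omega
  | succ r ih =>
    obtain ⟨κ', hκ', hne, hsl⟩ := exists_reduction (B := p ^ r) (S := 2 * 24 ^ r) hp hA hκ hlφ hM
      (by simpa only [pow_succ] using hkey) (fun x hx => by
        have := hslack x hx
        rwa [pow_succ, mul_comm (24 ^ r) 24, mul_left_comm] at this) hφ hproper hw hm hD
    have hA' : 𝓛.IsLocal (t + 1 + M * (2 ^ w * 2 ^ w)) (restrictBlock A (p ^ r) κ') :=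
      ((hA.mono (by omega)).prodMk hκ').comp fun v => v.1.filter fun c => c / p ^ r = v.2
    obtain ⟨y, hy, hmem, hyp⟩ := ih (hlφ.mono (by omega)) hA' hκ'
      (fun x => (Nat.log_mono_right (Finset.card_filter_le _ _)).trans_lt (hM x))
      (fun x c hc => (Finset.mem_filter.1 hc).2) hsl
    refine ⟨y, hy.mono (le_of_eq (by ring)), fun x hx =>
      (Finset.mem_filter.1 (hmem x (hne x hx))).1, ?_⟩
    intro x hx u hu hAu _ heq
    by_cases h : κ' u = κ' x
    · exact hyp x (hne x hx) u hu (hne u hAu) h heq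
    · apply h
      rw [← (Finset.mem_filter.1 (hmem u (hne u hAu))).2,
        ← (Finset.mem_filter.1 (hmem x (hne x hx))).2, heq]

/-- List coloring when the lists are larger than the degrees by a factor exponential in the depth
`r` of the color space reduction. -/
theorem exists_coloring_of_slack {φ : Ω → ℕ} {p M m w D r : ℕ} (hp : 0 < p)
    (hφ : ∀ x, φ x < m) (hproper : ∀ x, ∀ u ∈ 𝓛.nbr x, φ u ≠ φ x) (hw : w ≠ 0)
    (hm : m ≤ (2 ^ w) ^ D) (hD : 2 * p * D ≤ 2 ^ w) {A : Ω → Finset ℕ}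
    (hlφ : 𝓛.IsLocal t φ) (hA : 𝓛.IsLocal t A)
    (hM : ∀ x, Nat.log 2 (A x).card < M) (hlt : ∀ x, ∀ c ∈ A x, c < p ^ r)
    (hslack : ∀ x, (A x).Nonempty →
      2 * 24 ^ r * ((𝓛.nbr x).filter fun u => (A u).Nonempty).card ≤ (A x).card) :
    ∃ y : Ω → ℕ, 𝓛.IsLocal (t + r * (1 + M * (2 ^ w * 2 ^ w))) y ∧
      (∀ x, (A x).Nonempty → y x ∈ A x) ∧
      ∀ x, (A x).Nonempty → ∀ u ∈ 𝓛.nbr x, (A u).Nonempty → y u ≠ y x := by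
  obtain ⟨y, h1, h2, h3⟩ := exists_coloring_of_rivals (κ := fun _ => 0) hp hφ hproper hw hm hD hlφ
    hA (IsLocal.const 0) hM (fun x c hc => Nat.div_eq_of_lt (hlt x c hc)) (fun x hx => by
      refine le_trans (Nat.mul_le_mul_left _ (Finset.card_le_card ?_)) (hslack x hx)
      intro u hu
      simp only [rivals, Finset.mem_filter] at hu ⊢
      exact ⟨hu.1, hu.2.1⟩)
  exact ⟨y, h1, h2, fun x hx u hu hAu => h3 x hx u hu hAu rfl⟩

/-! ### Removing the slack assumption by halving degrees. -/

/-- An instance of the list coloring problem with lists larger than the degrees, an initial proper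
coloring `φ`, and parameters of the color space reduction. -/
structure ListInstance (𝓛 : LocalStructure Ω) (L : Ω → Finset ℕ) (φ : Ω → ℕ)
    (t p r M w D : ℕ) : Prop where
  list_local : 𝓛.IsLocal t L
  card_nbr_lt : ∀ x, (𝓛.nbr x).card < (L x).card
  lt_pow : ∀ x, ∀ c ∈ L x, c < p ^ r
  log_lt : ∀ x, Nat.log 2 (L x).card < M
  color_local : 𝓛.IsLocal t φ
  color_lt : ∀ x, φ x < (2 ^ w) ^ D
  color_ne : ∀ x, ∀ u ∈ 𝓛.nbr x, φ u ≠ φ x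
  pos : 0 < p
  ne_zero : w ≠ 0
  le_pow : 2 * p * D ≤ 2 ^ w
  le_pow' : 2 * (2 * 24 ^ r) * D ≤ 2 ^ w

variable (𝓛) in
/-- A proper coloring from lists of a part of the vertices. -/
def IsPartialColoring (L : Ω → Finset ℕ) (col : Ω → Option ℕ) : Prop :=
  ∀ x c, col x = some c → c ∈ L x ∧ ∀ u ∈ 𝓛.nbr x, col u ≠ some c

variable (𝓛) in
/-- The number of uncolored neighbors. -/
noncomputable def uncoloredDegree (col : Ω → Option ℕ) (x : Ω) : ℕ :=
  ((𝓛.nbr x).filter fun u => col u = none).card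

variable (𝓛) in
/-- The colors of the list that no neighbor has. -/
noncomputable def available (L : Ω → Finset ℕ) (col : Ω → Option ℕ) (x : Ω) : Finset ℕ :=
  (L x).filter fun c => ¬ ∃ u ∈ 𝓛.nbr x, col u = some c

/-- Each colored neighbor removes at most one color from the list, so lists stay larger than degrees
in the uncolored part. -/
theorem uncoloredDegree_lt_card_available {L : Ω → Finset ℕ} (col : Ω → Option ℕ) {x : Ω}
    (h : (𝓛.nbr x).card < (L x).card) :
    𝓛.uncoloredDegree col x < (𝓛.available L col x).card := by
  have h1 := Finset.card_filter_add_card_filter_not (s := L x)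
    (fun c => ∃ u ∈ 𝓛.nbr x, col u = some c)
  have h2 := Finset.card_filter_add_card_filter_not (s := 𝓛.nbr x) (fun u => col u = none)
  have h3 : ((L x).filter fun c => ∃ u ∈ 𝓛.nbr x, col u = some c).card ≤
      ((𝓛.nbr x).filter fun u => ¬ col u = none).card := by
    refine (Finset.card_le_card (t := ((𝓛.nbr x).filter fun u => ¬ col u = none).image
      fun u => (col u).getD 0) ?_).trans Finset.card_image_le
    intro c hc
    obtain ⟨-, u, hu, he⟩ := Finset.mem_filter.1 hc
    exact Finset.mem_image.2 ⟨u, Finset.mem_filter.2 ⟨hu, by simp [he]⟩, by simp [he]⟩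
  rw [uncoloredDegree, available]
  omega

theorem uncoloredDegree_le {col col' : Ω → Option ℕ} (h : ∀ x, col x ≠ none → col' x ≠ none)
    (x : Ω) : 𝓛.uncoloredDegree col' x ≤ 𝓛.uncoloredDegree col x := by
  refine Finset.card_le_card fun u hu => ?_
  simp only [Finset.mem_filter] at hu ⊢
  exact ⟨hu.1, by_contra fun hn => h u hn hu.2⟩

theorem IsLocal.uncoloredDegree {col : Ω → Option ℕ} (h : 𝓛.IsLocal t col) :
    𝓛.IsLocal (t + 1) (𝓛.uncoloredDegree col) :=
  h.card_nbr fun _ v => v = none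

namespace ListInstance

variable {L : Ω → Finset ℕ} {φ : Ω → ℕ} {s p r M w D : ℕ}

/-- The active vertices can be colored if their available colors outnumber their active neighbors
sufficiently. -/
theorem exists_extension (I : 𝓛.ListInstance L φ s p r M w D) (hst : s ≤ t)
    {col : Ω → Option ℕ} (hcol : 𝓛.IsLocal t col) (hpart : 𝓛.IsPartialColoring L col)
    {act : Ω → Prop} (hact : 𝓛.IsLocal t act)
    (hslack : ∀ x, act x → 2 * 24 ^ r * ((𝓛.nbr x).filter act).card ≤
      (𝓛.available L col x).card) :
    ∃ col' : Ω → Option ℕ, 𝓛.IsLocal (t + 1 + r * (1 + M * (2 ^ w * 2 ^ w))) col' ∧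
      𝓛.IsPartialColoring L col' ∧ (∀ x, col x ≠ none → col' x ≠ none) ∧
      ∀ x, act x → col' x ≠ none := by
  have hav : 𝓛.IsLocal (t + 1) (𝓛.available L col) := by
    intro x y hr
    have h1 : ∀ c, (∃ u ∈ 𝓛.nbr x, col u = some c) = ∃ u ∈ 𝓛.nbr y, col u = some c :=
      fun c => hcol.exists_nbr (fun _ v => v = some c) hr
    simp only [available, h1, I.list_local (rel_mono (by omega) hr)]
  -- The empty list encodes inactivity; active vertices always have an available color.
  let A : Ω → Finset ℕ := fun x => if act x then 𝓛.available L col x else ∅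
  have hA : 𝓛.IsLocal (t + 1) A :=
    ((hact.mono (Nat.le_succ t)).prodMk hav).comp fun v => if v.1 then v.2 else ∅
  have hsub : ∀ x, A x ⊆ L x := by
    intro x
    simp only [A]
    split_ifs
    · exact Finset.filter_subset _ _
    · exact Finset.empty_subset _
  have hAne : ∀ x, (A x).Nonempty ↔ act x := by
    intro x
    by_cases h : act x
    · simp only [A, h, if_true, iff_true]
      exact Finset.card_pos.1 ((Nat.zero_le _).trans_lt
        (uncoloredDegree_lt_card_available col (I.card_nbr_lt x)))
    · simp [A, h]
  obtain ⟨y, hy, hmem, hne⟩ := exists_coloring_of_slack I.pos I.color_lt I.color_ne I.ne_zero le_rfl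
    I.le_pow (I.color_local.mono (by omega)) hA
    (fun x => (Nat.log_mono_right (Finset.card_le_card (hsub x))).trans_lt (I.log_lt x))
    (fun x c hc => I.lt_pow x c (hsub x hc)) (by
      intro x hx
      have hx := (hAne x).1 hx
      simp only [hAne]
      simpa only [A, hx, if_true] using hslack x hx)
  simp only [hAne] at hmem hne
  refine ⟨fun x => if act x then some (y x) else col x, ?_, ?_, ?_, ?_⟩
  · exact (((hact.mono (by omega)).prodMk hy).prodMk (hcol.mono (by omega))).comp
      fun v => if v.1.1 then some v.1.2 else v.2
  · have hyav : ∀ x, act x → y x ∈ L x ∧ ∀ u ∈ 𝓛.nbr x, col u ≠ some (y x) := by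
      intro x hx
      have := hmem x hx
      simp only [A, hx, if_true, available, Finset.mem_filter] at this
      exact ⟨this.1, fun u hu he => this.2 ⟨u, hu, he⟩⟩
    intro x c hc
    by_cases hx : act x
    · simp only [hx, if_true, Option.some.injEq] at hc
      subst hc
      refine ⟨(hyav x hx).1, fun u hu => ?_⟩
      by_cases hu' : act u
      · simpa [hu'] using hne x hx u hu hu'
      · simpa [hu'] using (hyav x hx).2 u hu
    · simp only [hx, if_false] at hc
      refine ⟨(hpart x c hc).1, fun u hu => ?_⟩
      by_cases hu' : act u
      · simp only [hu', if_true, ne_eq, Option.some.injEq]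
        rintro rfl
        exact (hyav u hu').2 x (𝓛.nbr_symm hu) hc
      · simpa [hu'] using (hpart x c hc).2 u hu
  · intro x hx
    by_cases h : act x
    · simp [h]
    · simpa [h] using hx
  · intro x hx
    simp [hx]

/-- A phase that halves the degrees of the graph of uncolored vertices. -/
theorem exists_phase (I : 𝓛.ListInstance L φ s p r M w D) (hst : s ≤ t) {h : ℕ}
    {col : Ω → Option ℕ} (hcol : 𝓛.IsLocal t col) (hpart : 𝓛.IsPartialColoring L col)
    (hdeg : ∀ x, col x = none → 𝓛.uncoloredDegree col x < 2 ^ h) :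
    ∃ col' : Ω → Option ℕ,
      𝓛.IsLocal (t + (1 + 2 ^ w * 2 ^ w * (2 + r * (1 + M * (2 ^ w * 2 ^ w))))) col' ∧
      𝓛.IsPartialColoring L col' ∧
      ∀ x, col' x = none → 2 * 𝓛.uncoloredDegree col' x + 1 < 2 ^ h := by
  obtain ⟨ψ, hψ, hψlt, hdef⟩ := exists_defective (I.color_local.mono hst) I.color_lt I.color_ne
    I.ne_zero le_rfl I.le_pow' hcol (fun _ v => v = none)
  set q := 2 ^ w * 2 ^ w
  set τ := 2 + r * (1 + M * q) with hτ
  have key : ∀ j, ∃ col' : Ω → Option ℕ, 𝓛.IsLocal (t + 1 + j * τ) col' ∧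
      𝓛.IsPartialColoring L col' ∧ (∀ x, col x ≠ none → col' x ≠ none) ∧
      ∀ x, ψ x < j → col' x = none → 2 * 𝓛.uncoloredDegree col' x + 1 < 2 ^ h := by
    intro j
    induction j with
    | zero => exact ⟨col, hcol.mono (by omega), hpart, fun _ h => h, fun x hx => by omega⟩
    | succ j ih =>
      obtain ⟨c₁, hc₁, hp₁, he₁, hd₁⟩ := ih
      -- Only vertices whose uncolored degree is still too high act. They have more than `2 ^ h / 2`
      -- available colors, while the defect leaves fewer than `2 ^ h / (2 * (2 * 24 ^ r))` active
      -- neighbors.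
      let act : Ω → Prop := fun x =>
        c₁ x = none ∧ ψ x = j ∧ 2 ^ h ≤ 2 * 𝓛.uncoloredDegree c₁ x + 1
      have hact : 𝓛.IsLocal (t + 1 + j * τ + 1) act :=
        (((hc₁.mono (Nat.le_succ _)).prodMk (hψ.mono (by omega))).prodMk hc₁.uncoloredDegree).comp
          fun v => v.1.1 = none ∧ v.1.2 = j ∧ 2 ^ h ≤ 2 * v.2 + 1
      obtain ⟨c₂, hc₂, hp₂, he₂, ha₂⟩ := I.exists_extension (by omega)
        (hc₁.mono (Nat.le_succ _)) hp₁ hact (by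
          rintro x ⟨hx, hxj, hxd⟩
          have hx0 : col x = none := by_contra fun hn => he₁ x hn hx
          have h1 : 2 * (2 * 24 ^ r * ((𝓛.nbr x).filter fun u => col u = none ∧ ψ u = ψ x).card) ≤
              𝓛.uncoloredDegree col x := by
            have := hdef x
            rw [mul_assoc 2] at this
            rw [uncoloredDegree]
            convert this
          have h2 := hdeg x hx0
          have h3 := uncoloredDegree_lt_card_available c₁ (I.card_nbr_lt x)
          refine le_trans (Nat.mul_le_mul_left _ (Finset.card_le_card
            (t := (𝓛.nbr x).filter fun u => col u = none ∧ ψ u = ψ x) fun u hu => ?_)) (by omega)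
          simp only [Finset.mem_filter, act] at hu ⊢
          exact ⟨hu.1, by_contra fun hn => he₁ u hn hu.2.1, hu.2.2.1.trans hxj.symm⟩)
      refine ⟨c₂, hc₂.mono (le_of_eq (by rw [hτ, Nat.succ_eq_add_one]; ring)), hp₂, fun x hx => he₂ x (he₁ x hx), ?_⟩
      intro x hx hn
      have hn₁ : c₁ x = none := by_contra fun hn' => he₂ x hn' hn
      have hle := uncoloredDegree_le he₂ x (𝓛 := 𝓛)
      rcases Nat.lt_succ_iff_lt_or_eq.1 hx with hx | hx
      · have := hd₁ x hx hn₁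
        omega
      · by_contra hcon
        exact ha₂ x ⟨hn₁, hx, by omega⟩ hn
  obtain ⟨col', h1, h2, -, h3⟩ := key q
  exact ⟨col', h1.mono (le_of_eq (by ring)), h2, fun x => h3 x (hψlt x)⟩

/-- The bound `2 * d + 1 < 2 ^ h` left by a phase gives `d < 2 ^ (h - 1)` for positive `h` and is
impossible for `h = 0`; hence `h + 1` phases leave no vertex uncolored. -/
theorem exists_list_coloring (I : 𝓛.ListInstance L φ s p r M w D) {h : ℕ}
    (hdeg : ∀ x, (𝓛.nbr x).card < 2 ^ h) :
    ∃ y : Ω → ℕ,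
      𝓛.IsLocal (s + (h + 1) * (1 + 2 ^ w * 2 ^ w * (2 + r * (1 + M * (2 ^ w * 2 ^ w))))) y ∧
      ∀ x, y x ∈ L x ∧ ∀ u ∈ 𝓛.nbr x, y u ≠ y x := by
  set τ := 1 + 2 ^ w * 2 ^ w * (2 + r * (1 + M * (2 ^ w * 2 ^ w)))
  have key : ∀ h t, s ≤ t → ∀ col : Ω → Option ℕ, 𝓛.IsLocal t col → 𝓛.IsPartialColoring L col →
      (∀ x, col x = none → 𝓛.uncoloredDegree col x < 2 ^ h) →
      ∃ col' : Ω → Option ℕ, 𝓛.IsLocal (t + (h + 1) * τ) col' ∧ 𝓛.IsPartialColoring L col' ∧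
        ∀ x, col' x ≠ none := by
    intro h
    induction h with
    | zero =>
      intro t hst col hcol hpart hd
      obtain ⟨c, h1, h2, h3⟩ := I.exists_phase hst hcol hpart hd
      exact ⟨c, h1.mono (by simp [τ]), h2, fun x hx => by have := h3 x hx; simp at this⟩
    | succ h ih =>
      intro t hst col hcol hpart hd
      obtain ⟨c, h1, h2, h3⟩ := I.exists_phase hst hcol hpart hd
      obtain ⟨c', h1', h2', h3'⟩ := ih (t + τ) (by omega) c h1 h2 (fun x hx => by
        have := h3 x hx
        rw [pow_succ] at this
        omega)
      exact ⟨c', h1'.mono (le_of_eq (by ring)), h2', h3'⟩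
  obtain ⟨c, h1, h2, h3⟩ := key h s le_rfl (fun _ => none) (IsLocal.const _)
    (fun x c hc => by simp at hc)
    (fun x _ => (Finset.card_filter_le _ _).trans_lt (hdeg x))
  have hc : ∀ x, c x = some ((c x).getD 0) := fun x => by
    obtain ⟨a, ha⟩ := Option.ne_none_iff_exists'.1 (h3 x)
    simp [ha]
  refine ⟨fun x => (c x).getD 0, h1.comp fun v => v.getD 0, fun x => ?_⟩
  refine ⟨(h2 x _ (hc x)).1, fun u hu he => (h2 x _ (hc x)).2 u hu ?_⟩
  exact (hc u).trans (congrArg some he)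

end ListInstance

end LocalStructure

/-! ### The iterated logarithm and Linial's color reduction. -/

theorem logb_two_le_sub_one {x : ℝ} (hx : 2 ≤ x) : Real.logb 2 x ≤ x - 1 := by
  rw [Real.logb_le_iff_le_rpow one_lt_two (by linarith)]
  have := one_add_mul_self_le_rpow_one_add (s := 1) (by norm_num) (p := x - 1) (by linarith)
  norm_num at this
  exact this

/-- The infimum must be attained, as `sInf ∅ = 0`. If no iterate were at most 1, each would be at
least 2, its logarithm exceeding 1, and every step would subtract at least 1. -/
theorem iterate_logb_logStar_le_one (n : ℕ) : (Real.logb 2)^[logStar n] (n : ℝ) ≤ 1 := by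
  have hne : {k : ℕ | (Real.logb 2)^[k] (n : ℝ) ≤ 1}.Nonempty := by
    by_contra hcon
    have h1 : ∀ k, 1 < (Real.logb 2)^[k] (n : ℝ) := fun k => by
      by_contra h
      exact hcon ⟨k, not_lt.1 h⟩
    have h2 : ∀ k, 2 ≤ (Real.logb 2)^[k] (n : ℝ) := fun k => by
      have h := h1 (k + 1)
      rw [Function.iterate_succ_apply',
        Real.lt_logb_iff_rpow_lt one_lt_two (by linarith [h1 k])] at h
      simpa using h.le
    have h3 : ∀ k : ℕ, (Real.logb 2)^[k] (n : ℝ) ≤ n - k := fun k => by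
      induction k with
      | zero => simp
      | succ k ih =>
        rw [Function.iterate_succ_apply']
        push_cast
        linarith [logb_two_le_sub_one (h2 k)]
    have := h3 n
    linarith [h2 n]
  exact Nat.sInf_mem hne

theorem logStar_pos {n : ℕ} (hn : 2 ≤ n) : 0 < logStar n := by
  by_contra h
  have h1 := iterate_logb_logStar_le_one n
  rw [Nat.eq_zero_of_not_pos h, Function.iterate_zero_apply] at h1
  have h2 : (n : ℝ) ≤ (1 : ℕ) := by exact_mod_cast h1
  have := Nat.cast_le.1 h2
  omega

theorem clog_two_le_of_le {b κ : ℕ} {x : ℝ} (hx : 1 ≤ x) (hb : (b : ℝ) ≤ 2 ^ κ * x) :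
    (Nat.clog 2 b : ℝ) ≤ κ + Real.logb 2 x + 1 := by
  have hx0 : (0 : ℝ) < x := by linarith
  have hl : 0 ≤ Real.logb 2 x := Real.logb_nonneg one_lt_two hx
  have h1 : Nat.clog 2 b ≤ ⌈(κ : ℝ) + Real.logb 2 x⌉₊ := by
    apply Nat.clog_le_of_le_pow
    have h2 : (b : ℝ) ≤ 2 ^ (⌈(κ : ℝ) + Real.logb 2 x⌉₊ : ℝ) := by
      calc (b : ℝ) ≤ 2 ^ κ * x := hb
        _ = 2 ^ ((κ : ℝ) + Real.logb 2 x) := by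
            rw [Real.rpow_add two_pos, Real.rpow_natCast,
              Real.rpow_logb two_pos (by norm_num) hx0]
        _ ≤ _ := Real.rpow_le_rpow_of_exponent_le one_le_two (Nat.le_ceil _)
    rw [Real.rpow_natCast] at h2
    exact_mod_cast h2
  have h2 : (⌈(κ : ℝ) + Real.logb 2 x⌉₊ : ℝ) < κ + Real.logb 2 x + 1 :=
    Nat.ceil_lt_add_one (by positivity)
  have h3 : (Nat.clog 2 b : ℝ) ≤ ⌈(κ : ℝ) + Real.logb 2 x⌉₊ := by exact_mod_cast h1
  linarith

namespace LocalStructure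

open scoped Classical

variable {Ω : Type*} {𝓛 : LocalStructure Ω} {t : ℕ}

/-- One step of Linial's color reduction. -/
theorem exists_color_reduction {φ : Ω → ℕ} {a b w : ℕ} (hφ : 𝓛.IsLocal t φ)
    (hlt : ∀ x, φ x < 2 ^ b) (hproper : ∀ x, ∀ u ∈ 𝓛.nbr x, φ u ≠ φ x)
    (hdeg : ∀ x, (𝓛.nbr x).card < 2 ^ a) (hw : w ≠ 0) (hb : 2 ^ a * b ≤ 2 ^ w) :
    ∃ ψ : Ω → ℕ, 𝓛.IsLocal (t + 1) ψ ∧ (∀ x, ψ x < 2 ^ (2 * w)) ∧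
      ∀ x, ∀ u ∈ 𝓛.nbr x, ψ u ≠ ψ x := by
  -- With `X = 2 ^ a` above all degrees, the defect is zero.
  obtain ⟨ψ, h1, h2, h3⟩ := exists_defective hφ hlt hproper hw (D := b)
    (by rw [← pow_mul]; exact Nat.pow_le_pow_right two_pos
          (Nat.le_mul_of_pos_left _ (Nat.pos_of_ne_zero hw))) hb
    (IsLocal.const ()) (fun _ _ => True)
  refine ⟨ψ, h1, fun x => (h2 x).trans_eq (by rw [two_mul, pow_add]), fun x u hu he => ?_⟩
  have h4 := (h3 x).trans_lt ((Finset.card_filter_le _ _).trans_lt (hdeg x))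
  have h5 : 0 < ((𝓛.nbr x).filter fun u => True ∧ ψ u = ψ x).card :=
    Finset.card_pos.2 ⟨u, by simp [hu, he]⟩
  have h6 := Nat.le_mul_of_pos_right (2 ^ a) h5
  omega

/-- Linial's color reduction, iterated. -/
theorem exists_poly_coloring {φ : Ω → ℕ} {a c n : ℕ} (hn : 2 ≤ n) (hφ : 𝓛.IsLocal 0 φ)
    (hlt : ∀ x, φ x < (n ^ c) ^ 2) (hproper : ∀ x, ∀ u ∈ 𝓛.nbr x, φ u ≠ φ x)
    (hdeg : ∀ x, (𝓛.nbr x).card < 2 ^ a) :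
    ∃ (ψ : Ω → ℕ) (b : ℕ), 𝓛.IsLocal (logStar n) ψ ∧ (∀ x, ψ x < 2 ^ b) ∧
      b ≤ 4 * a + 2 * 2 ^ (2 * c + 6) + 2 ∧ ∀ x, ∀ u ∈ 𝓛.nbr x, ψ u ≠ ψ x := by
  -- Large enough for `4 * κ + 10 ≤ 2 ^ κ`, which lets the invariant below survive a step.
  set κ := 2 * c + 6 with hκ
  have hκK : 4 * κ + 10 ≤ 2 ^ κ := by
    rw [hκ, pow_add, pow_mul]
    have := Nat.lt_pow_self (n := c) (a := 2 ^ 2) (by norm_num)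
    have h1 : 0 < (2 ^ 2) ^ c := by positivity
    omega
  have hκK' : (4 * κ + 10 : ℝ) ≤ 2 ^ κ := by exact_mod_cast hκK
  have hn' : (2 : ℝ) ≤ n := by exact_mod_cast hn
  let x : ℕ → ℝ := fun j => (Real.logb 2)^[j + 1] (n : ℝ)
  have hx0 : 1 ≤ x 0 := by
    simp only [x, zero_add, Function.iterate_one]
    rw [Real.le_logb_iff_rpow_le one_lt_two (by linarith)]
    simpa using hn'
  -- Until it reaches `4 * a + 2`, the number of bits follows the iterated logarithm up to the
  -- factor `2 ^ κ`. A step maps `b` to `2 * (a + clog b + 1)`, and the two cases are which of `a`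
  -- and `clog b` dominates.
  have key : ∀ j, (∀ i < j, 2 ≤ x i) → ∃ (ψ : Ω → ℕ) (b : ℕ), 𝓛.IsLocal j ψ ∧
      (∀ x, ψ x < 2 ^ b) ∧ (b ≤ 4 * a + 2 ∨ (b : ℝ) ≤ 2 ^ κ * x j) ∧
      ∀ x, ∀ u ∈ 𝓛.nbr x, ψ u ≠ ψ x := by
    intro j
    induction j with
    | zero =>
      intro _
      refine ⟨φ, 2 * c * Nat.clog 2 n, hφ, fun y => (hlt y).trans_le ?_, Or.inr ?_, hproper⟩
      · calc (n ^ c) ^ 2 ≤ ((2 ^ Nat.clog 2 n) ^ c) ^ 2 := by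
              gcongr
              exact Nat.le_pow_clog one_lt_two n
          _ = _ := by rw [← pow_mul, ← pow_mul]; congr 1; ring
      · have h1 := clog_two_le_of_le (b := n) (κ := 0) (x := n) (by linarith) (by simp)
        have h2 : Real.logb 2 n = x 0 := rfl
        rw [h2] at h1
        push_cast at h1 ⊢
        have h3 : (4 * c : ℝ) ≤ 2 ^ κ := by
          refine le_trans ?_ hκK'
          rw [hκ]; push_cast
          linarith [Nat.cast_nonneg (α := ℝ) c]
        calc (2 * c * Nat.clog 2 n : ℝ) ≤ 2 * c * (2 * x 0) := by gcongr; linarith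
          _ = 4 * c * x 0 := by ring
          _ ≤ _ := by gcongr
    | succ j ih =>
      intro hj
      obtain ⟨ψ, b, h1, h2, h3, h4⟩ := ih fun i hi => hj i (by omega)
      rcases h3 with h3 | h3
      · exact ⟨ψ, b, h1.mono (Nat.le_succ _), h2, Or.inl h3, h4⟩
      · obtain ⟨ψ', h1', h2', h4'⟩ := exists_color_reduction (w := a + Nat.clog 2 b + 1) h1 h2 h4
          hdeg (by omega) (by
            rw [pow_succ, pow_add]
            have := Nat.mul_le_mul_left (2 ^ a) (Nat.le_pow_clog one_lt_two b)
            omega)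
        refine ⟨ψ', _, h1', h2', ?_, h4'⟩
        by_cases hba : Nat.clog 2 b ≤ a
        · left
          omega
        · right
          have h5 := clog_two_le_of_le (by linarith [hj j (by omega)]) h3
          have h6 : x (j + 1) = Real.logb 2 (x j) := Function.iterate_succ_apply' _ _ _
          have h7 : 1 ≤ Real.logb 2 (x j) := by
            rw [Real.le_logb_iff_rpow_le one_lt_two (by linarith [hj j (by omega)])]
            simpa using hj j (by omega)
          have h8 : (2 * (a + Nat.clog 2 b + 1) : ℕ) ≤ 4 * Nat.clog 2 b + 2 := by omega
          have h9 : ((2 * (a + Nat.clog 2 b + 1) : ℕ) : ℝ) ≤ 4 * Nat.clog 2 b + 2 := by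
            exact_mod_cast h8
          rw [h6]
          nlinarith
  have hk := logStar_pos hn
  have hex : ∃ j, x j ≤ 2 := ⟨logStar n - 1, by
    have := iterate_logb_logStar_le_one n
    simp only [x, Nat.sub_add_cancel hk]
    linarith⟩
  have hle : Nat.find hex ≤ logStar n := by
    refine (Nat.find_min' hex (m := logStar n - 1) ?_).trans (Nat.sub_le _ _)
    have := iterate_logb_logStar_le_one n
    simp only [x, Nat.sub_add_cancel hk]
    linarith
  obtain ⟨ψ, b, h1, h2, h3, h4⟩ := key (Nat.find hex) fun i hi =>
    (not_le.1 (Nat.find_min hex hi)).le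
  refine ⟨ψ, b, h1.mono hle, h2, ?_, h4⟩
  rcases h3 with h3 | h3
  · omega
  · have h5 : (b : ℝ) ≤ 2 * 2 ^ κ := by
      have := Nat.find_spec hex
      have hp : (0 : ℝ) < 2 ^ κ := by positivity
      nlinarith
    have h6 : b ≤ 2 * 2 ^ κ := by exact_mod_cast h5
    omega

end LocalStructure

/-! ### Views, and algorithms that collect them. -/

/-- Everything that a node can learn in the `LOCAL` model: its identifier and the data on its edges,
and, round by round, what its neighbors knew. -/
inductive View (ε : Type) : Type
  | base (i : ℕ) (inc : ℕ → Option ε) : View ε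
  | next (s : View ε) (inbox : ℕ → Option (View ε)) : View ε

section AtNeighbors

variable {V : Type*} {α : Type} {G : SimpleGraph V} {ID : V → ℕ}

theorem atNeighbors_of_adj (hID : Function.Injective ID) {v u : V} (h : G.Adj v u) (f : V → α) :
    atNeighbors G ID v f (ID u) = some (f u) := by
  have hex : ∃ w, G.Adj v w ∧ ID w = ID u := ⟨u, h, rfl⟩
  rw [atNeighbors, dif_pos hex, hID hex.choose_spec.2]

theorem exists_adj_of_atNeighbors {v : V} {f : V → α} {i : ℕ} {a : α}
    (h : atNeighbors G ID v f i = some a) : ∃ u, G.Adj v u ∧ ID u = i ∧ f u = a := by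
  rw [atNeighbors] at h
  split_ifs at h with hex
  exact ⟨hex.choose, hex.choose_spec.1, hex.choose_spec.2, by simpa using h⟩

end AtNeighbors

/-- The view of a node after `t` rounds. -/
noncomputable def viewAfter {ε : Type} {V : Type*} (G : SimpleGraph V) (ID : V → ℕ)
    (inp : Sym2 V → ε) : ℕ → V → View ε
  | 0 => fun v => .base (ID v) (atNeighbors G ID v fun u => inp s(v, u))
  | t + 1 => fun v => .next (viewAfter G ID inp t v) (atNeighbors G ID v (viewAfter G ID inp t))

section ViewAfter

variable {ε : Type} {V W : Type*} {G : SimpleGraph V} {ID : V → ℕ} {inp : Sym2 V → ε}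
  {G' : SimpleGraph W} {ID' : W → ℕ} {inp' : Sym2 W → ε} {t : ℕ} {v : V} {v' : W}

theorem viewAfter_of_succ (h : viewAfter G ID inp (t + 1) v = viewAfter G' ID' inp' (t + 1) v') :
    viewAfter G ID inp t v = viewAfter G' ID' inp' t v' :=
  (View.next.inj h).1

theorem viewAfter_zero_eq (h : viewAfter G ID inp t v = viewAfter G' ID' inp' t v') :
    viewAfter G ID inp 0 v = viewAfter G' ID' inp' 0 v' := by
  induction t with
  | zero => exact h
  | succ t ih => exact ih (viewAfter_of_succ h)

theorem id_eq_of_viewAfter (h : viewAfter G ID inp t v = viewAfter G' ID' inp' t v') :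
    ID v = ID' v' :=
  (View.base.inj (viewAfter_zero_eq h)).1

theorem inp_eq_of_viewAfter (hID : Function.Injective ID) (hID' : Function.Injective ID')
    (h : viewAfter G ID inp t v = viewAfter G' ID' inp' t v') {u : V} {u' : W} (hu : G.Adj v u)
    (hu' : G'.Adj v' u') (he : ID u = ID' u') : inp s(v, u) = inp' s(v', u') := by
  have h1 := congrFun (View.base.inj (viewAfter_zero_eq h)).2 (ID u)
  rw [atNeighbors_of_adj hID hu, he, atNeighbors_of_adj hID' hu'] at h1
  exact Option.some.inj h1

theorem exists_adj_of_viewAfter (hID : Function.Injective ID)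
    (h : viewAfter G ID inp (t + 1) v = viewAfter G' ID' inp' (t + 1) v') {u : V}
    (hu : G.Adj v u) :
    ∃ u', G'.Adj v' u' ∧ ID u = ID' u' ∧ viewAfter G ID inp t u = viewAfter G' ID' inp' t u' := by
  have h1 := congrFun (View.next.inj h).2 (ID u)
  rw [atNeighbors_of_adj hID hu] at h1
  obtain ⟨u', h2, h3, h4⟩ := exists_adj_of_atNeighbors h1.symm
  exact ⟨u', h2, h3.symm, h4.symm⟩

theorem viewAfter_eq_of_adj (hID : Function.Injective ID) (hID' : Function.Injective ID')
    (h : viewAfter G ID inp (t + 1) v = viewAfter G' ID' inp' (t + 1) v') {u : V} {u' : W} (hu : G.Adj v u) (he : ID u = ID' u') :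
    viewAfter G ID inp t u = viewAfter G' ID' inp' t u' := by
  obtain ⟨w, -, h2, h3⟩ := exists_adj_of_viewAfter hID h hu
  rw [h3, hID' (h2.symm.trans he)]

end ViewAfter

namespace LocalAlgorithm

variable {γ ε Out : Type}

/-- The algorithm that collects its view for a number of rounds that depends on the globally known
parameters, and then decides. -/
def ofDecision (T : ℕ → ℕ → γ → ℕ) (dec : ℕ → ℕ → γ → View ε → Out) : LocalAlgorithm γ ε Out where
  State := ℕ × (ℕ × ℕ × γ) × View ε
  Msg := View ε
  init n Δ g i inc := (0, (n, Δ, g), .base i inc)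
  send s _ := s.2.2
  recv s inbox := (s.1 + 1, s.2.1, .next s.2.2 inbox)
  output s := if s.1 = T s.2.1.1 s.2.1.2.1 s.2.1.2.2 then
    some (dec s.2.1.1 s.2.1.2.1 s.2.1.2.2 s.2.2) else none

variable (T : ℕ → ℕ → γ → ℕ) (dec : ℕ → ℕ → γ → View ε → Out) {V : Type*} [Fintype V]
  (G : SimpleGraph V) [DecidableRel G.Adj] (ID : V → ℕ) (g : γ) (inp : Sym2 V → ε)

theorem run_ofDecision (t : ℕ) (v : V) : (ofDecision T dec).run G ID g inp t v =
    (t, (Fintype.card V, G.maxDegree, g), viewAfter G ID inp t v) := by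
  induction t generalizing v with
  | zero => rfl
  | succ t ih =>
    simp only [run, ih]
    rfl

theorem outputsWithin_ofDecision (v : V) :
    (ofDecision T dec).OutputsWithin G ID g inp (T (Fintype.card V) G.maxDegree g) v
      (dec (Fintype.card V) G.maxDegree g
        (viewAfter G ID inp (T (Fintype.card V) G.maxDegree g) v)) := by
  refine ⟨_, le_rfl, ?_, fun r hr => ?_⟩
  · rw [run_ofDecision]
    simp [ofDecision]
  · rw [run_ofDecision]
    simp [ofDecision, hr.ne]

end LocalAlgorithm

/-! ### The line graphs of all networks as one local structure. -/

/-- The networks with `n` nodes and maximum degree `Δ`, with lists from the color space `𝒞`. -/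
structure ListNetwork (k c n Δ : ℕ) (𝒞 : Finset ℕ) where
  /-- the nodes -/
  V : Type*
  [fintype : Fintype V]
  /-- the network -/
  G : SimpleGraph V
  [decAdj : DecidableRel G.Adj]
  /-- the identifiers -/
  ID : V → ℕ
  /-- the lists -/
  L : Sym2 V → Finset ℕ
  card_eq : Fintype.card V = n
  maxDegree_eq : G.maxDegree = Δ
  injective : Function.Injective ID
  id_lt : ∀ v, ID v < n ^ c
  card_le : 𝒞.card ≤ k * Δ ^ k
  subset : ∀ e ∈ G.edgeSet, L e ⊆ 𝒞
  le_card : ∀ u v, G.Adj u v → G.degree u + G.degree v - 1 ≤ (L s(u, v)).card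

attribute [instance] ListNetwork.fintype ListNetwork.decAdj

namespace ListNetwork

open scoped Classical

universe u

variable {k c n Δ : ℕ} {𝒞 : Finset ℕ}

variable (k c n Δ 𝒞) in
/-- The edges of all networks. -/
abbrev Edge : Type (u + 1) := Σ N : ListNetwork.{u} k c n Δ 𝒞, N.G.edgeSet

/-- The edge between two adjacent nodes. -/
def edge (N : ListNetwork.{u} k c n Δ 𝒞) {v w : N.V} (h : N.G.Adj v w) : Edge.{u} k c n Δ 𝒞 :=
  ⟨N, ⟨s(v, w), h⟩⟩

/-- The view of a node. -/
noncomputable abbrev view (N : ListNetwork.{u} k c n Δ 𝒞) (t : ℕ) (v : N.V) : View (Finset ℕ) :=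
  viewAfter N.G N.ID N.L t v

theorem edge_comm (N : ListNetwork.{u} k c n Δ 𝒞) {v w : N.V} (h : N.G.Adj v w) :
    N.edge h = N.edge h.symm := by
  simp only [edge, Sym2.eq_swap (a := v)]

theorem edge_inj (N : ListNetwork.{u} k c n Δ 𝒞) {v w v' w' : N.V} {h : N.G.Adj v w}
    {h' : N.G.Adj v' w'} : N.edge h = N.edge h' ↔ s(v, w) = s(v', w') := by
  simp only [edge, Sigma.mk.injEq, heq_eq_eq, true_and]
  exact Subtype.mk.injEq _ _ _ _ |>.to_iff

theorem exists_edge (x : Edge.{u} k c n Δ 𝒞) :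
    ∃ (N : ListNetwork.{u} k c n Δ 𝒞) (v w : N.V) (h : N.G.Adj v w), x = N.edge h := by
  obtain ⟨N, ⟨e, he⟩⟩ := x
  induction e using Sym2.ind with
  | _ v w => exact ⟨N, v, w, he, rfl⟩

/-- The edges that share an endpoint with an edge. -/
noncomputable def edgeNbr (x : Edge.{u} k c n Δ 𝒞) : Finset (Edge.{u} k c n Δ 𝒞) :=
  (Finset.univ.filter fun f => x.1.G.lineGraph.Adj x.2 f).map (Function.Embedding.sigmaMk x.1)

theorem mem_edgeNbr_iff {x y : Edge.{u} k c n Δ 𝒞} :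
    y ∈ edgeNbr x ↔ ∃ f, x.1.G.lineGraph.Adj x.2 f ∧ ⟨x.1, f⟩ = y := by
  simp [edgeNbr]

theorem mem_edgeNbr {N : ListNetwork.{u} k c n Δ 𝒞} {v w : N.V} (h : N.G.Adj v w)
    {y : Edge.{u} k c n Δ 𝒞} : y ∈ edgeNbr (N.edge h) ↔
      (∃ (z : N.V) (h' : N.G.Adj v z), z ≠ w ∧ y = N.edge h') ∨
      ∃ (z : N.V) (h' : N.G.Adj w z), z ≠ v ∧ y = N.edge h' := by
  rw [mem_edgeNbr_iff]
  constructor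
  · rintro ⟨⟨f, hf⟩, hadj, rfl⟩
    obtain ⟨hne, hex⟩ := SimpleGraph.lineGraph_adj_iff_exists.1 hadj
    change ∃ z : N.V, z ∈ s(v, w) ∧ z ∈ f at hex
    obtain ⟨z, hz, z', rfl⟩ := hex
    rcases Sym2.mem_iff.1 hz with rfl | rfl
    · exact Or.inl ⟨z', hf, fun he => hne (Subtype.ext (by simp [edge, he])), rfl⟩
    · exact Or.inr ⟨z', hf, fun he => hne (Subtype.ext (by simp [edge, he, Sym2.eq_swap])), rfl⟩
  · rintro (⟨z, h', hne, rfl⟩ | ⟨z, h', hne, rfl⟩)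
    · refine ⟨⟨s(v, z), h'⟩, SimpleGraph.lineGraph_adj_iff_exists.2
        ⟨fun he => hne ?_, v, Sym2.mem_mk_left _ _, Sym2.mem_mk_left _ _⟩, rfl⟩
      exact (Sym2.congr_right.1 (congrArg Subtype.val he)).symm
    · refine ⟨⟨s(w, z), h'⟩, SimpleGraph.lineGraph_adj_iff_exists.2
        ⟨fun he => hne ?_, w, Sym2.mem_mk_right _ _, Sym2.mem_mk_left _ _⟩, rfl⟩
      exact (Sym2.congr_right.1 (Sym2.eq_swap.trans (congrArg Subtype.val he))).symm

/-- A number that identifies an edge in its network. -/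
noncomputable def edgeId (x : Edge.{u} k c n Δ 𝒞) : ℕ :=
  Sym2.lift ⟨fun v w => max (x.1.ID v) (x.1.ID w) * n ^ c + min (x.1.ID v) (x.1.ID w),
    fun v w => by simp only [max_comm, min_comm]⟩ (x.2 : Sym2 x.1.V)

theorem edgeId_edge {N : ListNetwork.{u} k c n Δ 𝒞} {v w : N.V} (h : N.G.Adj v w) :
    edgeId (N.edge h) = max (N.ID v) (N.ID w) * n ^ c + min (N.ID v) (N.ID w) := rfl

theorem edgeId_lt (x : Edge.{u} k c n Δ 𝒞) : edgeId x < (n ^ c) ^ 2 := by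
  obtain ⟨N, v, w, h, rfl⟩ := exists_edge x
  rw [edgeId_edge]
  have h1 : max (N.ID v) (N.ID w) + 1 ≤ n ^ c := max_lt (N.id_lt v) (N.id_lt w)
  have h2 : min (N.ID v) (N.ID w) < n ^ c := min_lt_of_left_lt (N.id_lt v)
  have h3 := Nat.mul_le_mul_right (n ^ c) h1
  rw [add_mul, one_mul, ← sq] at h3
  omega

theorem edge_eq_of_edgeId_eq {N : ListNetwork.{u} k c n Δ 𝒞} {v w v' w' : N.V}
    {h : N.G.Adj v w} {h' : N.G.Adj v' w'} (he : edgeId (N.edge h) = edgeId (N.edge h')) :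
    N.edge h = N.edge h' := by
  rw [edgeId_edge, edgeId_edge] at he
  have h1 : min (N.ID v) (N.ID w) < n ^ c := min_lt_of_left_lt (N.id_lt v)
  have h2 : min (N.ID v') (N.ID w') < n ^ c := min_lt_of_left_lt (N.id_lt v')
  have h3 := congrArg (· % n ^ c) he
  -- The identifiers of the endpoints are the two digits of the edge identifier in base `n ^ c`.
  simp only [Nat.mul_add_mod_self_right, Nat.mod_eq_of_lt h1, Nat.mod_eq_of_lt h2] at h3
  rw [h3, add_left_inj] at he
  have h4 := Nat.eq_of_mul_eq_mul_right (by omega) he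
  rw [edge_inj, Sym2.eq_iff]
  have : (N.ID v = N.ID v' ∧ N.ID w = N.ID w') ∨ (N.ID v = N.ID w' ∧ N.ID w = N.ID v') := by
    omega
  simpa only [N.injective.eq_iff] using this

/-- Two edges look the same to their endpoints after `t` rounds. -/
def EdgeRel (t : ℕ) (x y : Edge.{u} k c n Δ 𝒞) : Prop :=
  ∃ (N N' : ListNetwork.{u} k c n Δ 𝒞) (v w : N.V) (v' w' : N'.V) (h : N.G.Adj v w)
    (h' : N'.G.Adj v' w'), x = N.edge h ∧ y = N'.edge h' ∧
    N.view t v = N'.view t v' ∧ N.view t w = N'.view t w'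

theorem EdgeRel.exists_nbr {t : ℕ} {x y : Edge.{u} k c n Δ 𝒞} (hr : EdgeRel (t + 1) x y) :
    ∀ e ∈ edgeNbr x, ∃ f ∈ edgeNbr y, EdgeRel t e f := by
  obtain ⟨N, N', v, w, v', w', h, h', rfl, rfl, hv, hw⟩ := hr
  have main : ∀ {v w : N.V} {v' w' : N'.V} (h : N.G.Adj v w) (h' : N'.G.Adj v' w'),
      N.view (t + 1) v = N'.view (t + 1) v' → N.view (t + 1) w = N'.view (t + 1) w' →
      ∀ (z : N.V) (hz : N.G.Adj v z), z ≠ w →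
        ∃ (z' : N'.V) (hz' : N'.G.Adj v' z'), z' ≠ w' ∧ EdgeRel t (N.edge hz) (N'.edge hz') := by
    intro v w v' w' h h' hv hw z hz hne
    obtain ⟨z', hz', hid, hview⟩ := exists_adj_of_viewAfter N.injective hv hz
    refine ⟨z', hz', ?_, N, N', v, z, v', z', hz, hz', rfl, rfl, viewAfter_of_succ hv, hview⟩
    rintro rfl
    exact hne (N.injective (hid.trans (id_eq_of_viewAfter hw).symm))
  intro e he
  rcases (mem_edgeNbr h).1 he with ⟨z, hz, hne, rfl⟩ | ⟨z, hz, hne, rfl⟩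
  · obtain ⟨z', hz', hne', hrel⟩ := main h h' hv hw z hz hne
    exact ⟨_, (mem_edgeNbr h').2 (Or.inl ⟨z', hz', hne', rfl⟩), hrel⟩
  · obtain ⟨z', hz', hne', hrel⟩ := main h.symm h'.symm hw hv z hz hne
    exact ⟨_, (mem_edgeNbr h').2 (Or.inr ⟨z', hz', hne', rfl⟩), hrel⟩

theorem edgeNbr_symm {x y : Edge.{u} k c n Δ 𝒞} (h : y ∈ edgeNbr x) : x ∈ edgeNbr y := by
  obtain ⟨f, hf, rfl⟩ := mem_edgeNbr_iff.1 h
  exact mem_edgeNbr_iff.2 ⟨x.2, hf.symm, rfl⟩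

theorem exists_of_mem_edgeNbr {N : ListNetwork.{u} k c n Δ 𝒞} {v w : N.V} {h : N.G.Adj v w}
    {y : Edge.{u} k c n Δ 𝒞} (hy : y ∈ edgeNbr (N.edge h)) :
    ∃ (v' w' : N.V) (h' : N.G.Adj v' w'), y = N.edge h' ∧ y ≠ N.edge h := by
  rcases (mem_edgeNbr h).1 hy with ⟨z, hz, hne, rfl⟩ | ⟨z, hz, hne, rfl⟩
  · exact ⟨v, z, hz, rfl, fun he => hne (Sym2.congr_right.1 (edge_inj N |>.1 he))⟩
  · refine ⟨w, z, hz, rfl, fun he => hne ?_⟩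
    rw [edge_comm N h, edge_inj] at he
    exact Sym2.congr_right.1 he

variable (k c n Δ 𝒞) in
/-- The line graphs of all networks. -/
noncomputable def localStructure : LocalStructure (Edge.{u} k c n Δ 𝒞) where
  nbr := edgeNbr
  uid := edgeId
  rel := EdgeRel
  nbr_symm := edgeNbr_symm
  uid_inj := by
    intro x y z hy hz he
    obtain ⟨N, v, w, h, rfl⟩ := exists_edge x
    obtain ⟨_, _, _, rfl, -⟩ := exists_of_mem_edgeNbr hy
    obtain ⟨_, _, _, rfl, -⟩ := exists_of_mem_edgeNbr hz
    exact edge_eq_of_edgeId_eq he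
  uid_ne := by
    intro x y hy he
    obtain ⟨N, v, w, h, rfl⟩ := exists_edge x
    obtain ⟨_, _, _, rfl, hne⟩ := exists_of_mem_edgeNbr hy
    exact hne (edge_eq_of_edgeId_eq he)
  rel_symm := by
    rintro t x y ⟨N, N', v, w, v', w', h, h', rfl, rfl, hv, hw⟩
    exact ⟨N', N, v', w', v, w, h', h, rfl, rfl, hv.symm, hw.symm⟩
  rel_uid := by
    rintro t x y ⟨N, N', v, w, v', w', h, h', rfl, rfl, hv, hw⟩
    rw [edgeId_edge, edgeId_edge, id_eq_of_viewAfter hv, id_eq_of_viewAfter hw]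
  rel_of_succ := by
    rintro t x y ⟨N, N', v, w, v', w', h, h', rfl, rfl, hv, hw⟩
    exact ⟨N, N', v, w, v', w', h, h', rfl, rfl, viewAfter_of_succ hv, viewAfter_of_succ hw⟩
  rel_nbr := EdgeRel.exists_nbr
  two_cliques := by
    intro x
    obtain ⟨N, v, w, h, rfl⟩ := exists_edge x
    refine ⟨fun y => ∃ (z : N.V) (h' : N.G.Adj v z), z ≠ w ∧ y = N.edge h', ?_⟩
    intro y hy y' hy' hiff hne
    have main : ∀ {v z z' : N.V} (hz : N.G.Adj v z) (hz' : N.G.Adj v z'),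
        N.edge hz ≠ N.edge hz' → N.edge hz' ∈ edgeNbr (N.edge hz) := by
      intro v z z' hz hz' hne
      refine (mem_edgeNbr hz).2 (Or.inl ⟨z', hz', ?_, rfl⟩)
      rintro rfl
      exact hne rfl
    by_cases hP : ∃ (z : N.V) (h' : N.G.Adj v z), z ≠ w ∧ y = N.edge h'
    · obtain ⟨z', hz', -, rfl⟩ := hiff.1 hP
      obtain ⟨z, hz, -, rfl⟩ := hP
      exact main hz hz' hne
    · obtain ⟨z, hz, -, rfl⟩ := ((mem_edgeNbr h).1 hy).resolve_left hP
      obtain ⟨z', hz', -, rfl⟩ := ((mem_edgeNbr h).1 hy').resolve_left fun h => hP (hiff.2 h)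
      exact main hz hz' hne

/-- The list of an edge. -/
def list (x : Edge.{u} k c n Δ 𝒞) : Finset ℕ := x.1.L x.2

theorem isLocal_list : (localStructure.{u} k c n Δ 𝒞).IsLocal 0 list := by
  rintro x y ⟨N, N', v, w, v', w', h, h', rfl, rfl, hv, hw⟩
  exact inp_eq_of_viewAfter N.injective N'.injective hv h h' (id_eq_of_viewAfter hw)

theorem isLocal_edgeId : (localStructure.{u} k c n Δ 𝒞).IsLocal 0 edgeId :=
  fun _ _ hr => (localStructure.{u} k c n Δ 𝒞).rel_uid hr

/-- The edge itself is counted in both degrees, hence the 2. A list of size `deg + deg - 1` thus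
exceeds the number of neighboring edges. -/
theorem card_edgeNbr_add_two_le {N : ListNetwork.{u} k c n Δ 𝒞} {v w : N.V} (h : N.G.Adj v w) :
    (edgeNbr (N.edge h)).card + 2 ≤ N.G.degree v + N.G.degree w := by
  have h1 : edgeNbr (N.edge h) ⊆
      ((N.G.neighborFinset v).erase w).attach.image
        (fun z : (N.G.neighborFinset v).erase w =>
          N.edge ((N.G.mem_neighborFinset v z).1 (Finset.mem_of_mem_erase z.2))) ∪
      ((N.G.neighborFinset w).erase v).attach.image
        (fun z : (N.G.neighborFinset w).erase v =>
          N.edge ((N.G.mem_neighborFinset w z).1 (Finset.mem_of_mem_erase z.2))) := by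
    intro y hy
    rw [Finset.mem_union, Finset.mem_image, Finset.mem_image]
    rcases (mem_edgeNbr h).1 hy with ⟨z, hz, hne, rfl⟩ | ⟨z, hz, hne, rfl⟩
    · exact Or.inl ⟨⟨z, Finset.mem_erase.2 ⟨hne, (N.G.mem_neighborFinset v z).2 hz⟩⟩,
        Finset.mem_attach _ _, rfl⟩
    · exact Or.inr ⟨⟨z, Finset.mem_erase.2 ⟨hne, (N.G.mem_neighborFinset w z).2 hz⟩⟩,
        Finset.mem_attach _ _, rfl⟩
  have h2 := (Finset.card_le_card h1).trans (Finset.card_union_le _ _)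
  have h3 : ∀ {v w : N.V}, N.G.Adj v w →
      ((N.G.neighborFinset v).erase w).card + 1 = N.G.degree v := fun {v w} hvw =>
    Finset.card_erase_add_one ((N.G.mem_neighborFinset v w).2 hvw)
  have h4 := h3 h
  have h5 := h3 h.symm
  have h6 : ∀ (s : Finset N.V) (g : s → Edge.{u} k c n Δ 𝒞), (s.attach.image g).card ≤ s.card :=
    fun s g => Finset.card_image_le.trans Finset.card_attach.le
  have h7 := h2.trans (Nat.add_le_add (h6 _ _) (h6 _ _))
  omega

theorem card_edgeNbr_lt_card_list (x : Edge.{u} k c n Δ 𝒞) : (edgeNbr x).card < (list x).card := by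
  obtain ⟨N, v, w, h, rfl⟩ := exists_edge x
  have h1 := card_edgeNbr_add_two_le h
  have h2 : N.G.degree v + N.G.degree w - 1 ≤ (list (N.edge h)).card := N.le_card v w h
  omega

theorem card_edgeNbr_lt (x : Edge.{u} k c n Δ 𝒞) : (edgeNbr x).card < 2 * Δ := by
  obtain ⟨N, v, w, h, rfl⟩ := exists_edge x
  have h1 := card_edgeNbr_add_two_le h
  have h2 := N.G.degree_le_maxDegree v
  have h3 := N.G.degree_le_maxDegree w
  rw [N.maxDegree_eq] at h2 h3
  omega

theorem list_subset (x : Edge.{u} k c n Δ 𝒞) : list x ⊆ 𝒞 := x.1.subset _ x.2.2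

theorem two_le_of_edge (x : Edge.{u} k c n Δ 𝒞) : 2 ≤ n := by
  obtain ⟨N, v, w, h, rfl⟩ := exists_edge x
  rw [← N.card_eq]
  exact Fintype.one_lt_card_iff.2 ⟨v, w, h.ne⟩

theorem one_le_of_edge (x : Edge.{u} k c n Δ 𝒞) : 1 ≤ Δ := by
  have := card_edgeNbr_lt x
  omega

/-- The decision of a node with a given view after `T + 1` rounds, based on a function of the edges
that can be computed in `T` rounds. -/
noncomputable def decision (T : ℕ) (y : Edge.{u} k c n Δ 𝒞 → ℕ) (s : View (Finset ℕ)) (j : ℕ) : ℕ :=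
  Classical.epsilon fun a => ∃ (N : ListNetwork.{u} k c n Δ 𝒞) (v w : N.V) (h : N.G.Adj v w),
    N.view (T + 1) v = s ∧ N.ID w = j ∧ y (N.edge h) = a

/-- A node may imagine any network that fits its view. The extra round reveals the `T`-round view of
the other endpoint, found by its identifier, so the imagined edge is indistinguishable from the real
one. Both endpoints therefore output the same color. -/
theorem decision_eq {T : ℕ} {y : Edge.{u} k c n Δ 𝒞 → ℕ}
    (hy : (localStructure.{u} k c n Δ 𝒞).IsLocal T y) {N : ListNetwork.{u} k c n Δ 𝒞} {v w : N.V}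
    (h : N.G.Adj v w) : decision T y (N.view (T + 1) v) (N.ID w) = y (N.edge h) := by
  obtain ⟨N', v', w', h', h1, h2, h3⟩ := Classical.epsilon_spec
    (p := fun a => ∃ (N' : ListNetwork.{u} k c n Δ 𝒞) (v' w' : N'.V) (h : N'.G.Adj v' w'),
      N'.view (T + 1) v' = N.view (T + 1) v ∧ N'.ID w' = N.ID w ∧ y (N'.edge h) = a)
    ⟨y (N.edge h), N, v, w, h, rfl, rfl, rfl⟩
  rw [decision, ← h3]
  exact hy ⟨N', N, v', w', v, w, h', h, rfl, rfl, viewAfter_of_succ h1,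
    viewAfter_eq_of_adj N'.injective N.injective h1 h' h2⟩

end ListNetwork

/-! ### Choice of parameters and round bounds. -/

/-- The number of rounds of the list coloring algorithm after the initial coloring. -/
theorem rounds_le {k E s : ℕ} (hs : 1 ≤ s) :
    (s ^ 2 + 2) * (1 + 2 ^ (E * s) * 2 ^ (E * s) *
      (2 + 2 * k * s * (1 + (2 * k * s ^ 2 + 1) * (2 ^ (E * s) * 2 ^ (E * s))))) ≤
      2 ^ ((4 * k + 12 + 4 * E) * s) := by
  have hs2 : s ≤ 2 ^ s := Nat.lt_two_pow_self.le
  have hk2 : k ≤ 2 ^ k := Nat.lt_two_pow_self.le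
  have h2s : 2 ≤ 2 ^ s := Nat.le_self_pow (by omega) 2
  have hks : 2 ^ k ≤ 2 ^ (k * s) := Nat.pow_le_pow_right two_pos (Nat.le_mul_of_pos_right _ hs)
  set S := 2 ^ s with hS
  set K := 2 ^ (k * s) with hK
  set Q := 2 ^ (E * s) * 2 ^ (E * s) with hQ
  have hQ1 : 1 ≤ Q := Nat.pos_of_ne_zero (by positivity)
  have hK1 : 1 ≤ K := Nat.pos_of_ne_zero (by positivity)
  have hS1 : 1 ≤ S := Nat.pos_of_ne_zero (by positivity)
  have hkK : k ≤ K := hk2.trans hks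
  have hss : s ^ 2 ≤ S ^ 2 := Nat.pow_le_pow_left hs2 2
  have e1 : s ^ 2 + 2 ≤ S ^ 3 := by nlinarith
  have e2 : 2 * k * s ^ 2 + 1 ≤ K * S ^ 4 := by
    calc 2 * k * s ^ 2 + 1 ≤ S * K * S ^ 2 + 1 := by gcongr
      _ ≤ S * K * S ^ 2 + S * K * S ^ 2 := by gcongr; exact Nat.pos_of_ne_zero (by positivity)
      _ = 2 * (K * S ^ 3) := by ring
      _ ≤ S * (K * S ^ 3) := Nat.mul_le_mul_right _ h2s
      _ = _ := by ring
  have e3 : 1 + (2 * k * s ^ 2 + 1) * Q ≤ K * S ^ 5 * Q := by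
    calc 1 + (2 * k * s ^ 2 + 1) * Q ≤ K * S ^ 4 * Q + K * S ^ 4 * Q := by
          gcongr; exact Nat.pos_of_ne_zero (by positivity)
      _ = 2 * (K * S ^ 4 * Q) := by ring
      _ ≤ S * (K * S ^ 4 * Q) := Nat.mul_le_mul_right _ h2s
      _ = _ := by ring
  have e4 : 2 + 2 * k * s * (1 + (2 * k * s ^ 2 + 1) * Q) ≤ K ^ 2 * S ^ 8 * Q := by
    calc 2 + 2 * k * s * (1 + (2 * k * s ^ 2 + 1) * Q) ≤ S * 1 + S * K * S * (K * S ^ 5 * Q) := by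
          gcongr; omega
      _ ≤ S * (K ^ 2 * S ^ 6 * Q) + S * K * S * (K * S ^ 5 * Q) := by
          gcongr; exact Nat.pos_of_ne_zero (by positivity)
      _ = 2 * (K ^ 2 * S ^ 7 * Q) := by ring
      _ ≤ S * (K ^ 2 * S ^ 7 * Q) := Nat.mul_le_mul_right _ h2s
      _ = _ := by ring
  calc _ ≤ S ^ 3 * (1 + Q * (K ^ 2 * S ^ 8 * Q)) := by gcongr
    _ ≤ S ^ 3 * (Q * (K ^ 2 * S ^ 8 * Q) + Q * (K ^ 2 * S ^ 8 * Q)) := by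
        gcongr; exact Nat.pos_of_ne_zero (by positivity)
    _ = 2 * (K ^ 2 * S ^ 11 * Q ^ 2) := by ring
    _ ≤ S * (K ^ 2 * S ^ 11 * Q ^ 2) := Nat.mul_le_mul_right _ h2s
    _ = K ^ 2 * S ^ 12 * Q ^ 2 := by ring
    _ = 2 ^ ((2 * k + 12 + 4 * E) * s) := by
        rw [hS, hK, hQ]; simp only [← pow_mul, ← pow_add]; congr 1; ring
    _ ≤ _ := Nat.pow_le_pow_right two_pos (Nat.mul_le_mul_right _ (by omega))

namespace LocalStructure

variable {Ω : Type*} {𝓛 : LocalStructure Ω}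

/-- List coloring from a color space of polynomial size, with the number of rounds in terms of
`s ≥ √log₂ Δ`. -/
theorem exists_list_coloring_of_card_le (k c : ℕ) : ∃ A : ℕ, ∀ {Ω : Type*}
    {𝓛 : LocalStructure Ω} {φ : Ω → ℕ} {L : Ω → Finset ℕ} {𝒞 : Finset ℕ} {n Δ s : ℕ}, 2 ≤ n →
    1 ≤ s → Δ ≤ 2 ^ s ^ 2 → 𝓛.IsLocal 0 φ → (∀ x, φ x < (n ^ c) ^ 2) →
    (∀ x, ∀ u ∈ 𝓛.nbr x, φ u ≠ φ x) → 𝓛.IsLocal 0 L → (∀ x, L x ⊆ 𝒞) → 𝒞.card ≤ k * Δ ^ k →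
    (∀ x, (𝓛.nbr x).card < (L x).card) → (∀ x, (𝓛.nbr x).card < 2 * Δ) →
    ∃ y : Ω → ℕ, 𝓛.IsLocal (logStar n + 2 ^ (A * s)) y ∧
      ∀ x, y x ∈ L x ∧ ∀ u ∈ 𝓛.nbr x, y u ≠ y x := by
  set B := 2 * 2 ^ (2 * c + 6) + 10 with hB
  set E := 10 * k + B + 4 with hE
  refine ⟨4 * k + 12 + 4 * E, ?_⟩
  intro Ω 𝓛 φ L 𝒞 n Δ s hn hs hΔ hφ hφlt hφne hL hL𝒞 h𝒞 hcard hdeg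
  have hs2 : s ≤ s ^ 2 := Nat.le_self_pow two_ne_zero s
  have hdeg' : ∀ x, (𝓛.nbr x).card < 2 ^ (s ^ 2 + 1) := fun x => by
    rw [pow_succ]
    have := hdeg x
    omega
  obtain ⟨ψ, b, hψ, hψlt, hb, hψne⟩ := exists_poly_coloring hn hφ hφlt hφne hdeg'
  have hbB : b ≤ B * s ^ 2 := by
    have : B ≤ 4 + (B - 4) * s ^ 2 := by
      have := Nat.mul_le_mul_left (B - 4) (hs.trans hs2)
      omega
    have h1 : B * s ^ 2 = 4 * s ^ 2 + (B - 4) * s ^ 2 := by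
      rw [← add_mul]; congr 1; omega
    omega
  have hp : (2 ^ s) ^ (2 * k * s) = 2 ^ (2 * k * s ^ 2) := by rw [← pow_mul]; congr 1; ring
  have h𝒞' : 𝒞.card ≤ (2 ^ s) ^ (2 * k * s) := by
    rw [hp]
    calc 𝒞.card ≤ k * Δ ^ k := h𝒞
      _ ≤ 2 ^ k * (2 ^ s ^ 2) ^ k := Nat.mul_le_mul Nat.lt_two_pow_self.le (Nat.pow_le_pow_left hΔ k)
      _ = 2 ^ (k * 1 + k * s ^ 2) := by rw [← pow_mul, ← pow_add]; congr 1; ring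
      _ ≤ 2 ^ (2 * k * s ^ 2) := by
          apply Nat.pow_le_pow_right two_pos
          have := Nat.mul_le_mul_left k (hs.trans hs2)
          have h1 : 2 * k * s ^ 2 = k * s ^ 2 + k * s ^ 2 := by ring
          omega
  -- Colors are renumbered to lie below `p ^ r = 2 ^ (2 * k * s ^ 2)`; this needs no communication,
  -- since `𝒞` is known globally.
  obtain ⟨g, hg⟩ : ∃ g : ℕ → ℕ, Set.InjOn g 𝒞 ∧ ∀ a ∈ 𝒞, g a < 𝒞.card := by
    refine ⟨fun a => if h : a ∈ 𝒞 then 𝒞.equivFin ⟨a, h⟩ else 0, ?_, ?_⟩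
    · intro a ha a' ha' he
      rw [Finset.mem_coe] at ha ha'
      simp only [ha, ha', dite_true] at he
      simpa using 𝒞.equivFin.injective (Fin.ext he)
    · intro a ha
      simp [ha]
  have hLg : ∀ x, ((L x).image g).card = (L x).card := fun x =>
    Finset.card_image_of_injOn (hg.1.mono (by exact_mod_cast hL𝒞 x))
  have hsE : s ≤ E * s := Nat.le_mul_of_pos_left _ (by omega)
  have hD : B * s ≤ 2 ^ ((B + 1) * s) := by
    rw [add_mul B 1, one_mul, pow_add]
    refine Nat.mul_le_mul ?_ Nat.lt_two_pow_self.le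
    exact Nat.lt_two_pow_self.le.trans
      (Nat.pow_le_pow_right two_pos (Nat.le_mul_of_pos_right _ hs))
  have h2s : 2 ≤ 2 ^ s := Nat.le_self_pow (by omega) 2
  have I : 𝓛.ListInstance (fun x => (L x).image g) ψ (logStar n) (2 ^ s) (2 * k * s)
      (2 * k * s ^ 2 + 1) (E * s) (B * s) :=
    { list_local := (hL.mono (Nat.zero_le _)).comp fun l => l.image g
      card_nbr_lt := fun x => (hcard x).trans_eq (hLg x).symm
      lt_pow := fun x a ha => by
        obtain ⟨d, hd, rfl⟩ := Finset.mem_image.1 ha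
        exact (hg.2 d (hL𝒞 x hd)).trans_le h𝒞'
      log_lt := fun x => by
        rw [hLg]
        have h1 := (Finset.card_le_card (hL𝒞 x)).trans h𝒞'
        rw [hp] at h1
        have h2 := Nat.log_mono_right (b := 2) h1
        rw [Nat.log_pow one_lt_two] at h2
        omega
      color_local := hψ
      color_lt := fun x => (hψlt x).trans_le (by
        rw [← pow_mul]
        refine Nat.pow_le_pow_right two_pos (hbB.trans ?_)
        calc B * s ^ 2 = s * (B * s) := by ring
          _ ≤ _ := Nat.mul_le_mul_right _ hsE)
      color_ne := hψne
      pos := by positivity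
      ne_zero := by omega
      le_pow := by
        calc 2 * 2 ^ s * (B * s) ≤ 2 ^ s * 2 ^ s * 2 ^ ((B + 1) * s) := by gcongr
          _ = 2 ^ ((B + 3) * s) := by rw [← pow_add, ← pow_add]; congr 1; ring
          _ ≤ _ := Nat.pow_le_pow_right two_pos (Nat.mul_le_mul_right _ (by omega))
      le_pow' := by
        calc 2 * (2 * 24 ^ (2 * k * s)) * (B * s)
            ≤ 2 ^ s * (2 ^ s * (2 ^ 5) ^ (2 * k * s)) * 2 ^ ((B + 1) * s) := by
              gcongr; norm_num
          _ = 2 ^ ((10 * k + B + 3) * s) := by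
              rw [← pow_mul, ← pow_add, ← pow_add, ← pow_add]; congr 1; ring
          _ ≤ _ := Nat.pow_le_pow_right two_pos (Nat.mul_le_mul_right _ (by omega)) }
  obtain ⟨y, hy, hyL⟩ := I.exists_list_coloring hdeg'
  have hinv : ∀ x, Function.invFunOn g (L x) (y x) ∈ L x ∧
      g (Function.invFunOn g (L x) (y x)) = y x := fun x => by
    have hex : ∃ a ∈ (L x : Set ℕ), g a = y x := by
      simpa using (hyL x).1
    exact ⟨Function.invFunOn_mem hex, Function.invFunOn_eq hex⟩
  refine ⟨fun x => Function.invFunOn g (L x) (y x), ?_, fun x => ⟨(hinv x).1, fun u hu he => ?_⟩⟩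
  · refine IsLocal.mono (s := logStar n + (s ^ 2 + 1 + 1) * (1 + 2 ^ (E * s) * 2 ^ (E * s) *
      (2 + 2 * k * s * (1 + (2 * k * s ^ 2 + 1) * (2 ^ (E * s) * 2 ^ (E * s)))))) ?_
      (Nat.add_le_add_left (rounds_le hs) _)
    exact ((hL.mono (Nat.zero_le _)).prodMk hy).comp fun v => Function.invFunOn g v.1 v.2
  · refine (hyL x).2 u hu ?_
    rw [← (hinv u).2, ← (hinv x).2]
    exact congrArg g he

end LocalStructure

/-- The bound on the number of rounds in terms of the maximum degree. -/
theorem exists_sqrt_log_bound (A : ℕ) {n Δ : ℕ} (hn : 2 ≤ n) (hΔ : 1 ≤ Δ) :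
    ∃ s : ℕ, 1 ≤ s ∧ Δ ≤ 2 ^ s ^ 2 ∧ ((logStar n + 2 ^ (A * s) + 1 : ℕ) : ℝ) ≤
      2 ^ ((2 * (A + 1) : ℝ) * √(Real.logb 2 Δ)) + (2 ^ A + 2) * logStar n := by
  have hl : (1 : ℝ) ≤ logStar n := by exact_mod_cast logStar_pos hn
  have hΔ0 : (0 : ℝ) < Δ := by exact_mod_cast hΔ
  rcases hΔ.eq_or_lt with rfl | hΔ
  -- For `Δ = 1` the exponential term is only 1, so `2 ^ A` is charged to `log* n ≥ 1`.
  · refine ⟨1, le_rfl, by norm_num, ?_⟩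
    have h1 : (1 : ℝ) ≤ 2 ^ A := one_le_pow₀ one_le_two
    simp only [Nat.cast_one, Real.logb_one, Real.sqrt_zero, mul_zero, Real.rpow_zero, mul_one]
    push_cast
    nlinarith
  · set r := √(Real.logb 2 Δ) with hr
    have hlog : 1 ≤ Real.logb 2 Δ := by
      rw [Real.le_logb_iff_rpow_le one_lt_two hΔ0]
      have : (2 : ℝ) ≤ Δ := by exact_mod_cast hΔ
      simpa using this
    have hr1 : 1 ≤ r := Real.one_le_sqrt.2 hlog
    refine ⟨⌈r⌉₊, Nat.one_le_ceil_iff.2 (by linarith), ?_, ?_⟩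
    · have h1 : (Δ : ℝ) ≤ 2 ^ ((⌈r⌉₊ ^ 2 : ℕ) : ℝ) := by
        rw [← Real.logb_le_iff_le_rpow one_lt_two hΔ0]
        push_cast
        calc Real.logb 2 Δ = r ^ 2 := (Real.sq_sqrt (by linarith)).symm
          _ ≤ _ := by gcongr; exact Nat.le_ceil r
      rw [Real.rpow_natCast] at h1
      exact_mod_cast h1
    · have h1 : (⌈r⌉₊ : ℝ) ≤ 2 * r := by
        have := Nat.ceil_lt_add_one (zero_le_one.trans hr1)
        linarith
      have h2 : ((2 ^ (A * ⌈r⌉₊) + 1 : ℕ) : ℝ) ≤ 2 ^ ((2 * (A + 1) : ℝ) * r) := by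
        have h3 : 2 ^ (A * ⌈r⌉₊) + 1 ≤ 2 ^ ((A + 1) * ⌈r⌉₊) := by
          have h4 : 1 ≤ ⌈r⌉₊ := Nat.one_le_ceil_iff.2 (by linarith)
          calc 2 ^ (A * ⌈r⌉₊) + 1 ≤ 2 ^ (A * ⌈r⌉₊) * 2 ^ 1 := by
                have := Nat.one_le_two_pow (n := A * ⌈r⌉₊)
                omega
            _ ≤ 2 ^ (A * ⌈r⌉₊) * 2 ^ ⌈r⌉₊ := by gcongr; norm_num
            _ = _ := by rw [← pow_add]; congr 1; ring
        calc ((2 ^ (A * ⌈r⌉₊) + 1 : ℕ) : ℝ) ≤ ((2 ^ ((A + 1) * ⌈r⌉₊) : ℕ) : ℝ) := by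
              exact_mod_cast h3
          _ = 2 ^ (((A + 1) * ⌈r⌉₊ : ℕ) : ℝ) := by rw [Real.rpow_natCast]; push_cast; rfl
          _ ≤ _ := by
              apply Real.rpow_le_rpow_of_exponent_le one_le_two
              push_cast
              have : (0 : ℝ) ≤ A + 1 := by positivity
              nlinarith
      have h3 : (0 : ℝ) ≤ 2 ^ A := by positivity
      push_cast at h2 ⊢
      nlinarith

/-! ### The edge coloring algorithms. -/

namespace ListNetwork

universe u

/-- `T` and `y` depend only on data known to every node, so choosing them for all parameters yields
one algorithm. Without edges there is nothing to color; an edge supplies `2 ≤ n` and `1 ≤ Δ`. -/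
theorem exists_edge_coloring (k c : ℕ) : ∃ a b : ℝ, ∀ (n Δ : ℕ) (𝒞 : Finset ℕ),
    ∃ (T : ℕ) (y : Edge.{u} k c n Δ 𝒞 → ℕ),
      ((T + 1 : ℕ) : ℝ) ≤ 2 ^ (a * √(Real.logb 2 Δ)) + b * logStar n ∧
      (localStructure.{u} k c n Δ 𝒞).IsLocal T y ∧
      ∀ x, y x ∈ list x ∧ ∀ u ∈ edgeNbr x, y u ≠ y x := by
  obtain ⟨A, hA⟩ := LocalStructure.exists_list_coloring_of_card_le.{u + 1} k c
  refine ⟨2 * (A + 1), 2 ^ A + 2, fun n Δ 𝒞 => ?_⟩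
  rcases isEmpty_or_nonempty (Edge.{u} k c n Δ 𝒞) with hE | ⟨⟨x₀⟩⟩
  · refine ⟨0, fun _ => 0, ?_, LocalStructure.IsLocal.const 0, fun x => hE.elim x⟩
    have h1 : (1 : ℝ) ≤ 2 ^ ((2 * (A + 1) : ℝ) * √(Real.logb 2 Δ)) :=
      Real.one_le_rpow one_le_two (by positivity)
    have h2 : (0 : ℝ) ≤ (2 ^ A + 2) * logStar n := by positivity
    push_cast
    linarith
  · have hn := two_le_of_edge x₀
    obtain ⟨s, hs, hΔs, hT⟩ := exists_sqrt_log_bound A hn (one_le_of_edge x₀)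
    obtain ⟨y, hy, hyL⟩ := hA (𝓛 := localStructure.{u} k c n Δ 𝒞) hn hs hΔs isLocal_edgeId edgeId_lt
      (fun x u hu => (localStructure.{u} k c n Δ 𝒞).uid_ne hu) isLocal_list list_subset
      x₀.1.card_le card_edgeNbr_lt_card_list card_edgeNbr_lt
    exact ⟨_, y, hT, hy, hyL⟩

end ListNetwork

namespace LocalAlgorithm

universe u

/-- List edge coloring with lists of size at least `deg u + deg v - 1`. -/
theorem exists_list_edge_coloring (k c : ℕ) :
    ∃ (a b : ℝ) (A : LocalAlgorithm (Finset ℕ) (Finset ℕ) (ℕ → ℕ)),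
      ∀ (V : Type u) [Fintype V] (G : SimpleGraph V) [DecidableRel G.Adj]
        (ID : V → ℕ) (𝒞 : Finset ℕ) (L : Sym2 V → Finset ℕ),
        Function.Injective ID →
        (∀ v, ID v < Fintype.card V ^ c) →
        𝒞.card ≤ k * G.maxDegree ^ k →
        (∀ e ∈ G.edgeSet, L e ⊆ 𝒞) →
        (∀ u v, G.Adj u v → G.degree u + G.degree v - 1 ≤ (L s(u, v)).card) →
        ∃ (t : ℕ) (x : G.lineGraph.Coloring ℕ),
          (t : ℝ) ≤ 2 ^ (a * √(Real.logb 2 G.maxDegree)) + b * logStar (Fintype.card V) ∧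
          A.ComputesEdgeColoring G ID 𝒞 L t x ∧
          ∀ e : G.edgeSet, x e ∈ L e := by
  obtain ⟨a, b, h⟩ := ListNetwork.exists_edge_coloring.{u} k c
  choose T y hT hy hyL using h
  refine ⟨a, b, ofDecision (fun n Δ 𝒞 => T n Δ 𝒞 + 1)
    fun n Δ 𝒞 s => ListNetwork.decision (T n Δ 𝒞) (y n Δ 𝒞) s, ?_⟩
  intro V _ G _ ID 𝒞 L hinj hID h𝒞 hL𝒞 hL
  let N : ListNetwork.{u} k c (Fintype.card V) G.maxDegree 𝒞 :=
    { V := V, G := G, ID := ID, L := L, card_eq := rfl, maxDegree_eq := rfl, injective := hinj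
      id_lt := hID, card_le := h𝒞, subset := hL𝒞, le_card := hL }
  set y₀ := y (Fintype.card V) G.maxDegree 𝒞
  refine ⟨T (Fintype.card V) G.maxDegree 𝒞 + 1,
    SimpleGraph.Coloring.mk (fun e => y₀ ⟨N, e⟩) ?_, hT _ _ _, ?_, ?_⟩
  · intro e f hef
    exact (hyL _ _ _ ⟨N, f⟩).2 ⟨N, e⟩ (ListNetwork.mem_edgeNbr_iff.2 ⟨e, hef.symm, rfl⟩)
  · intro v
    refine ⟨_, outputsWithin_ofDecision _ _ G ID 𝒞 L v, fun u hu => ?_⟩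
    exact ListNetwork.decision_eq (hy _ _ _) (N := N) hu
  · intro e
    exact (hyL _ _ _ ⟨N, e⟩).1

/-- The algorithm for problems without input that runs `A` on an input determined by the maximum
degree. -/
def withInput {γ ε Out : Type} (A : LocalAlgorithm γ ε Out) (g : ℕ → γ) (l : ℕ → ε) :
    LocalAlgorithm Unit Unit Out where
  State := A.State
  Msg := A.Msg
  init n Δ _ i inc := A.init n Δ (g Δ) i fun j => (inc j).map fun _ => l Δ
  send := A.send
  recv := A.recv
  output := A.output

theorem run_withInput {γ ε Out : Type} (A : LocalAlgorithm γ ε Out) (g : ℕ → γ) (l : ℕ → ε)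
    {V : Type*} [Fintype V] (G : SimpleGraph V) [DecidableRel G.Adj] (ID : V → ℕ) (t : ℕ) :
    (A.withInput g l).run G ID () (fun _ => ()) t =
      A.run G ID (g G.maxDegree) (fun _ => l G.maxDegree) t := by
  induction t with
  | zero =>
    funext v
    simp only [run, withInput]
    congr 1
    funext j
    simp only [atNeighbors]
    split_ifs <;> rfl
  | succ t ih =>
    funext v
    simp only [run, ih]
    rfl

theorem computesEdgeColoring_withInput {γ ε : Type} (A : LocalAlgorithm γ ε (ℕ → ℕ)) (g : ℕ → γ)
    (l : ℕ → ε) {V : Type*} [Fintype V] (G : SimpleGraph V) [DecidableRel G.Adj] (ID : V → ℕ)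
    {t : ℕ} {x : G.lineGraph.Coloring ℕ}
    (h : A.ComputesEdgeColoring G ID (g G.maxDegree) (fun _ => l G.maxDegree) t x) :
    (A.withInput g l).ComputesEdgeColoring G ID () (fun _ => ()) t x := by
  intro v
  obtain ⟨o, ⟨s, hs, h1, h2⟩, ho⟩ := h v
  refine ⟨o, ⟨s, hs, ?_, fun r hr => ?_⟩, ho⟩
  · rw [run_withInput]
    exact h1
  · rw [run_withInput]
    exact h2 r hr

end LocalAlgorithm

theorem corollary4 :
    -- list edge coloring with lists of size at least `deg u + deg v - 1`
    (∀ k c : ℕ, ∃ (a b : ℝ) (A : LocalAlgorithm (Finset ℕ) (Finset ℕ) (ℕ → ℕ)),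
      ∀ (V : Type*) [Fintype V] (G : SimpleGraph V) [DecidableRel G.Adj]
        (ID : V → ℕ) (𝒞 : Finset ℕ) (L : Sym2 V → Finset ℕ),
        Function.Injective ID →
        (∀ v, ID v < Fintype.card V ^ c) →
        𝒞.card ≤ k * G.maxDegree ^ k →
        (∀ e ∈ G.edgeSet, L e ⊆ 𝒞) →
        (∀ u v, G.Adj u v → G.degree u + G.degree v - 1 ≤ (L s(u, v)).card) →
        ∃ (t : ℕ) (x : G.lineGraph.Coloring ℕ),
          (t : ℝ) ≤ 2 ^ (a * √(Real.logb 2 G.maxDegree)) + b * logStar (Fintype.card V) ∧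
          A.ComputesEdgeColoring G ID 𝒞 L t x ∧
          ∀ e : G.edgeSet, x e ∈ L e) ∧
    -- edge coloring with `2Δ - 1` colors
    (∀ c : ℕ, ∃ (a b : ℝ) (A : LocalAlgorithm Unit Unit (ℕ → ℕ)),
      ∀ (V : Type*) [Fintype V] (G : SimpleGraph V) [DecidableRel G.Adj] (ID : V → ℕ),
        Function.Injective ID →
        (∀ v, ID v < Fintype.card V ^ c) →
        ∃ (t : ℕ) (x : G.lineGraph.Coloring ℕ),
          (t : ℝ) ≤ 2 ^ (a * √(Real.logb 2 G.maxDegree)) + b * logStar (Fintype.card V) ∧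
          A.ComputesEdgeColoring G ID () (fun _ => ()) t x ∧
          ∀ e : G.edgeSet, x e < 2 * G.maxDegree - 1) := by
  refine ⟨LocalAlgorithm.exists_list_edge_coloring, fun c => ?_⟩
  obtain ⟨a, b, A, hA⟩ := LocalAlgorithm.exists_list_edge_coloring 2 c
  refine ⟨a, b, A.withInput (fun Δ => Finset.range (2 * Δ - 1)) fun Δ => Finset.range (2 * Δ - 1),
    ?_⟩
  intro V _ G _ ID hinj hID
  obtain ⟨t, x, ht, hx, hxL⟩ := hA V G ID (Finset.range (2 * G.maxDegree - 1))
    (fun _ => Finset.range (2 * G.maxDegree - 1)) hinj hID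
    (by
      rw [Finset.card_range]
      have := Nat.le_self_pow two_ne_zero G.maxDegree
      omega)
    (fun _ _ => subset_rfl)
    (fun u v _ => by
      rw [Finset.card_range]
      have h1 := G.degree_le_maxDegree u
      have h2 := G.degree_le_maxDegree v
      omega)
  exact ⟨t, x, ht, A.computesEdgeColoring_withInput _ _ G ID hx, fun e => by simpa using hxL e⟩
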